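/- Let $p$ be a prime, let $V$ be a Noetherian integral scheme of characteristic $p$, and let $f : X \to V$ be a separated, flat, geometrically reduced morphism of finite type. For $m \ge 0$ let $V^m$ be $V$ regarded as a $V$-scheme through the $m$-th iterated absolute Frobenius, put $X_{V^m} = X \times_V V^m$, and for a quasi-coherent sheaf $M$ on $X$ write $M^{1/p^m}$ for its direct image under the relative Frobenius $F^m_{X/V} : X \to X_{V^m}$. Fix an integer $e \ge 1$, a line bundle $L$ on $X$ and an $\mathcal O_{X_{V^e}}$-linear map $\varphi : L^{1/p^e} \to \mathcal O_{X_{V^e}}$ (possibly zero). Put $\varphi^0 = \mathrm{id}$ and let $$\varphi^n : \bigl(L^{\frac{p^{ne}-1}{p^e-1}}\bigr)^{1/p^{ne}} = \Bigl(L \otimes \bigl(L^{\frac{p^{(n-1)e}-1}{p^e-1}}\bigr)^{1/p^{(n-1)e}}\Bigr)^{1/p^e} \longrightarrow \bigl(L \otimes \mathcal O_{X_{V^{(n-1)e}}}\bigr)^{1/p^e} \longrightarrow \mathcal O_{X_{V^{ne}}}$$ be the composition of $(\mathrm{id}_L \otimes \varphi^{n-1})^{1/p^e}$ with the base change of $\varphi$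 along $V^{ne} \to V^e$. Let $\sigma_n(X/V,\varphi) \subseteq \mathcal O_{X_{V^{ne}}}$ be the image of $\varphi^n$. A perfect point of $V$ is a morphism $s = \operatorname{Spec} K \to V$ with $K$ a perfect field. Since $K^{1/p^m} = K$, the fiber $X_{s^{ne}}$ of $X_{V^{ne}} \to V^{ne}$ over $s$ is identified with $X_s = X \times_V s$, and the base change $\varphi_s$ of $\varphi$ to $s$ is identified with a $p^{-e}$-linear map $\psi_s : (L|_{X_s})^{1/p^e} \to \mathcal O_{X_s}$, where now $M^{1/p^e}$ denotes $F^e_* M$ for the absolute Frobenius of $X_s$. Let $\psi_s^n$ be its $n$-fold composition with itself and let $\sigma(X_s,\psi_s) = \bigcap_{n \ge 0} \operatorname{Im}(\psi_s^n) \subseteq \mathcal O_{X_s}$ be the absolute non-$F$-pure ideal. Then: (1) There is an integer $N \ge 0$ such that for all $n \ge N$ and all perfect points $s$ of $V$, $$\sigma_n(X/V,\varphi)\cdot \mathcal O_{X_{s^{ne}}} = \sigma(X_s,\psi_s).$$ (2) For every $n \ge 0$ and every morphism $g : T \to V$, the ideal $\sigma_n(X/V,\varphi)$ maps surjectively onto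 its base change: $\sigma_n(X/V,\varphi)\cdot \mathcal O_{X_{T^{ne}}} = \sigma_n(X_T/T,\varphi_T)$, where $X_T = X\times_V T$ and $\varphi_T$ is the base change of $\varphi$. -/

import Mathlib

open CategoryTheory CategoryTheory.Limits AlgebraicGeometry TopologicalSpace
open scoped TensorProduct

universe u

namespace RelFPure

noncomputable section

/-! ## Frobenius and `p^m`-th roots of rings -/

section Frobenius

variable {p : ℕ} [Fact p.Prime] {A : Type u} [CommRing A]

/-- The iterated Frobenius `x ↦ x ^ (p ^ m)` of a ring in which `p = 0`
(the zero ring is allowed). -/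
def frob (h : (p : A) = 0) (m : ℕ) : A →+* A where
  toFun x := x ^ p ^ m
  map_one' := one_pow _
  map_mul' x y := mul_pow x y _
  map_zero' := zero_pow (pow_ne_zero _ (Fact.out : p.Prime).ne_zero)
  map_add' x y := by
    rcases subsingleton_or_nontrivial A with _ | _
    · exact Subsingleton.elim _ _
    · have := (CharP.charP_iff_prime_eq_zero (Fact.out : p.Prime)).2 h
      exact add_pow_char_pow x y p m

/-- The ring `A^{1/p^m}`: the ring `A` itself, an element `a` standing for `a^{1/p^m}`.
It is an algebra over `A`, and over every ring mapping to `A`, through the `m`-th Frobenius. -/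
def RootRing (_h : (p : A) = 0) (_m : ℕ) : Type u := A

instance (h : (p : A) = 0) (m : ℕ) : CommRing (RootRing h m) := inferInstanceAs (CommRing A)

/-- The bijection `a ↦ a^{1/p^m}`, a ring isomorphism from `A` to `A^{1/p^m}`. -/
def toRoot (h : (p : A) = 0) (m : ℕ) : A ≃+* RootRing h m := RingEquiv.refl A

instance (h : (p : A) = 0) (m : ℕ) {A₀ : Type u} [CommRing A₀] [Algebra A₀ A] :
    Algebra A₀ (RootRing h m) :=
  (((toRoot h m).toRingHom.comp (frob h m)).comp (algebraMap A₀ A)).toAlgebra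

theorem algebraMap_root (h : (p : A) = 0) (m : ℕ) {A₀ : Type u} [CommRing A₀] [Algebra A₀ A]
    (a : A₀) : algebraMap A₀ (RootRing h m) a = toRoot h m (algebraMap A₀ A a ^ p ^ m) := rfl

end Frobenius

theorem natCast_eq_zero_of_ringHom {p : ℕ} {A B : Type u} [CommRing A] [CommRing B]
    (g : A →+* B) (h : (p : A) = 0) : (p : B) = 0 := by
  rw [← map_natCast g, h, map_zero]

/-! ## Absolute `p^{-e}`-linear maps -/

section Absolute

variable (p : ℕ) [Fact p.Prime] (e : ℕ) (S M : Type u) [CommRing S] [AddCommGroup M] [Module S M]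

/-- A `p^{-e}`-linear map `ψ : M → S`, that is an `S`-linear map `M^{1/p^e} → S`. -/
structure CartierMap where
  /-- the underlying additive map -/
  toFun : M →+ S
  map_pow_smul : ∀ (s : S) (x : M), toFun (s ^ p ^ e • x) = s * toFun x

variable {S}

/-- The `S`-module `(M^{1 + q + ⋯ + q^{n-1}})^{1/q^n}`, for `M` invertible, `q = p^e`
and `F` the `e`-th Frobenius of `S`: it is `S` for `n = 0`, and
`(M ⊗_S (M^{1 + q + ⋯ + q^{n-1}})^{1/q^n})^{1/q}` for `n + 1`. -/
def rootPower (F : S →+* S) : ℕ → ModuleCat.{u} S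
  | 0 => ModuleCat.of S S
  | n + 1 => (ModuleCat.restrictScalars F).obj (ModuleCat.of S (M ⊗[S] rootPower F n))

variable {p e M}

/-- The `n`-fold composition `ψ^n : (M^{1 + q + ⋯ + q^{n-1}})^{1/q^n} → S` with `q = p^e`:
the map `ψ^{n+1}` is the composition
`(M ⊗_S (M^{1 + q + ⋯ + q^{n-1}})^{1/q^n})^{1/q} → (M ⊗_S S)^{1/q} = M^{1/q} → S`
of `(id ⊗ ψ^n)^{1/q}` and `ψ`. -/
def CartierMap.pow (h : (p : S) = 0) (ψ : CartierMap p e S M) :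
    (n : ℕ) → rootPower M (frob h e) n →ₗ[S] S
  | 0 => LinearMap.id
  | n + 1 =>
    let g : M ⊗[S] rootPower M (frob h e) n →ₗ[S] M :=
      (TensorProduct.rid S M).toLinearMap ∘ₗ LinearMap.lTensor M (ψ.pow h n)
    { toFun := fun y => ψ.toFun (g y)
      map_add' := fun y z => (congrArg ψ.toFun (g.map_add y z)).trans (map_add _ _ _)
      map_smul' := fun s y =>
        (congrArg ψ.toFun (g.map_smul (frob h e s) y)).trans (ψ.map_pow_smul s _) }

/-- The absolute non-`F`-pure ideal `σ(S, ψ) = ⋂ₙ ψ^n ((M^{1 + q + ⋯ + q^{n-1}})^{1/q^n})`. -/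
def CartierMap.sigma (h : (p : S) = 0) (ψ : CartierMap p e S M) : Ideal S :=
  ⨅ n, LinearMap.range (ψ.pow h n)

end Absolute

/-! ## Relative `p^{-e}`-linear maps in the affine case -/

section Relative

variable {p : ℕ} [Fact p.Prime] {A : Type u} [CommRing A]

/-- An `R_{A^{1/p^e}}`-linear map `φ : L^{1/p^e} → R_{A^{1/p^e}} = R ⊗_A A^{1/p^e}`.
The element `r ⊗ a^{1/p^e}` acts on `L^{1/p^e}` as `r^{p^e} a` does on `L`. -/
structure RelCartierMap (h : (p : A) = 0) (e : ℕ) (R L : Type u) [CommRing R] [Algebra A R]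
    [AddCommGroup L] [Module R L] where
  /-- the underlying additive map -/
  toFun : L →+ R ⊗[A] RootRing h e
  map_pow_smul : ∀ (r : R) (l : L), toFun (r ^ p ^ e • l) = (r ⊗ₜ 1) * toFun l
  map_base_smul : ∀ (a : A) (l : L),
    toFun (algebraMap A R a • l) = (1 ⊗ₜ toRoot h e a) * toFun l

variable {h : (p : A) = 0} {e : ℕ} {R L : Type u} [CommRing R] [Algebra A R]
  [AddCommGroup L] [Module R L]

/-- Let `j : B → C` present `C` as the ring `B^{1/p^e}`, as an `A`-algebra. Then
`a^{1/p^e} ↦ a^{1/p^e}` is an `A`-algebra map from `A^{1/p^e}` to `C`. -/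
def rootLift (h : (p : A) = 0) (e : ℕ) {B C : Type u} [CommRing B] [CommRing C] [Algebra A B]
    [Algebra A C] (j : B →+* C) (hj : ∀ a, algebraMap A C a = j (algebraMap A B a) ^ p ^ e) :
    RootRing h e →ₐ[A] C :=
  { (j.comp (algebraMap A B)).comp (toRoot h e).symm.toRingHom with
    commutes' := fun a => by
      rw [hj, algebraMap_root]
      simp }

theorem rootLift_toRoot (h : (p : A) = 0) (e : ℕ) {B C : Type u} [CommRing B] [CommRing C]
    [Algebra A B] [Algebra A C] (j : B →+* C)
    (hj : ∀ a, algebraMap A C a = j (algebraMap A B a) ^ p ^ e) (a : A) :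
    rootLift h e j hj (toRoot h e a) = j (algebraMap A B a) := rfl

/-- Let `j : B → C` present `C` as the ring `B^{1/p^e}`, as an `A`-algebra.
This is `φ ⊗_{A^{1/p^e}} B^{1/p^e}` as a map from `(R_B ⊗_R L)^{1/p^e}` to `R ⊗_A B^{1/p^e}`:
`(r ⊗ b) ⊗ l ↦ φ (r l) b^{1/p^e}`. -/
def RelCartierMap.extend (φ : RelCartierMap h e R L) {B C : Type u} [CommRing B] [CommRing C]
    [Algebra A B] [Algebra A C] (j : B →+* C)
    (hj : ∀ a, algebraMap A C a = j (algebraMap A B a) ^ p ^ e) :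
    (R ⊗[A] B) ⊗[R] L →+ R ⊗[A] C :=
  let θ : R ⊗[A] RootRing h e →+* R ⊗[A] C :=
    (Algebra.TensorProduct.map (AlgHom.id A R) (rootLift h e j hj)).toRingHom
  let g (l : L) : R ⊗[A] B →+ R ⊗[A] C :=
    TensorProduct.liftAddHom
      { toFun := fun r => (AddMonoidHom.mulLeft (θ (φ.toFun (r • l)))).comp
          ((Algebra.TensorProduct.includeRight : C →ₐ[A] R ⊗[A] C).toRingHom.comp j).toAddMonoidHom
        map_zero' := by ext; simp
        map_add' := fun x y => by ext; simp [add_smul, add_mul] }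
      (fun a r b => by
        have : φ.toFun ((a • r) • l) = (1 ⊗ₜ toRoot h e a) * φ.toFun (r • l) := by
          rw [← φ.map_base_smul, Algebra.smul_def, mul_smul]
        change θ (φ.toFun ((a • r) • l)) * (1 ⊗ₜ j b) = θ (φ.toFun (r • l)) * (1 ⊗ₜ j (a • b))
        have hθ : θ (1 ⊗ₜ toRoot h e a) = 1 ⊗ₜ j (algebraMap A B a) := by
          simp [θ, rootLift_toRoot]
        rw [this, map_mul, hθ, mul_comm (1 ⊗ₜ[A] j _), mul_assoc,
          Algebra.TensorProduct.tmul_mul_tmul, one_mul, Algebra.smul_def, map_mul])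
  TensorProduct.liftAddHom
    { toFun := fun x =>
        { toFun := fun l => g l x
          map_zero' := by
            induction x using TensorProduct.induction_on with
            | zero => simp
            | tmul r b => simp [g]
            | add x y hx hy => rw [map_add, hx, hy, add_zero]
          map_add' := fun l l' => by
            induction x using TensorProduct.induction_on with
            | zero => simp
            | tmul r b => simp [g, add_mul]
            | add x y hx hy => rw [map_add, map_add, map_add, hx, hy]; abel }
      map_zero' := by ext; simp
      map_add' := fun x y => by ext; simp }
    (fun s x l => by
      change g l (s • x) = g (s • l) x
      induction x using TensorProduct.induction_on with
      | zero => simp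
      | tmul r b => simp [g, TensorProduct.smul_tmul', smul_smul, mul_comm]
      | add x y hx hy => rw [smul_add, map_add, map_add, hx, hy])

theorem RelCartierMap.extend_tmul (φ : RelCartierMap h e R L) {B C : Type u} [CommRing B]
    [CommRing C] [Algebra A B] [Algebra A C] (j : B →+* C)
    (hj : ∀ a, algebraMap A C a = j (algebraMap A B a) ^ p ^ e) (r : R) (b : B) (l : L) :
    φ.extend j hj ((r ⊗ₜ[A] b) ⊗ₜ[R] l) =
      Algebra.TensorProduct.map (AlgHom.id A R) (rootLift h e j hj) (φ.toFun (r • l)) *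
        (1 ⊗ₜ j b) := by
  simp [RelCartierMap.extend]

theorem RelCartierMap.extend_smul (φ : RelCartierMap h e R L) {B C : Type u} [CommRing B]
    [CommRing C] [Algebra A B] [Algebra A C] (j : B →+* C)
    (hj : ∀ a, algebraMap A C a = j (algebraMap A B a) ^ p ^ e) (r : R) (b : B)
    (y : (R ⊗[A] B) ⊗[R] L) :
    φ.extend j hj (((r ^ p ^ e) ⊗ₜ[A] b : R ⊗[A] B) • y) = (r ⊗ₜ j b) * φ.extend j hj y := by
  induction y using TensorProduct.induction_on with
  | zero => simp
  | add y z hy hz => rw [smul_add, map_add, map_add, hy, hz, mul_add]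
  | tmul x l =>
    induction x using TensorProduct.induction_on with
    | zero => simp
    | add y z hy hz => rw [TensorProduct.add_tmul, smul_add, map_add, map_add, hy, hz, mul_add]
    | tmul s c =>
      rw [TensorProduct.smul_tmul', smul_eq_mul, Algebra.TensorProduct.tmul_mul_tmul,
        extend_tmul, extend_tmul, mul_smul, φ.map_pow_smul, map_mul,
        Algebra.TensorProduct.map_tmul, map_one, map_mul, ← mul_assoc,
        mul_comm (_ ⊗ₜ[A] _) (Algebra.TensorProduct.map _ _ _),
        mul_comm (_ ⊗ₜ[A] _) (Algebra.TensorProduct.map _ _ _), mul_assoc, mul_assoc]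
      simp

theorem RelCartierMap.extend_pow_smul (φ : RelCartierMap h e R L) {B C : Type u} [CommRing B]
    [CommRing C] [Algebra A B] [Algebra A C] (j : B →+* C)
    (hj : ∀ a, algebraMap A C a = j (algebraMap A B a) ^ p ^ e) (r : R)
    (y : (R ⊗[A] B) ⊗[R] L) :
    φ.extend j hj (r ^ p ^ e • y) = r • φ.extend j hj y := by
  have h1 : r ^ p ^ e • y = ((r ^ p ^ e) ⊗ₜ[A] 1 : R ⊗[A] B) • y :=
    (algebraMap_smul (R ⊗[A] B) (r ^ p ^ e) y).symm
  rw [h1, extend_smul, map_one, Algebra.smul_def]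
  rfl

/-- `φ ⊗_{A^{1/p^e}} A^{1/p^{m+e}}`, as a map from `(R_{A^{1/p^m}} ⊗_R L)^{1/p^e}` to
`R_{A^{1/p^{m+e}}}`. -/
def RelCartierMap.twist (φ : RelCartierMap h e R L) (m : ℕ) :
    (R ⊗[A] RootRing h m) ⊗[R] L →+ R ⊗[A] RootRing h (m + e) :=
  φ.extend ((toRoot h (m + e)).toRingHom.comp (toRoot h m).symm.toRingHom) (fun a => by
    simp [algebraMap_root, pow_add, pow_mul])

/-- The `n`-fold composition
`φ^n : (L^{1 + q + ⋯ + q^{n-1}})^{1/q^n} → R_{A^{1/q^n}}` with `q = p^e`: the map `φ^{n+1}` is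
`(L ⊗_R (L^{1 + q + ⋯ + q^{n-1}})^{1/q^n})^{1/q} → (L ⊗_R R_{A^{1/q^n}})^{1/q} → R_{A^{1/q^{n+1}}}`,
the first arrow being `(id ⊗ φ^n)^{1/q}` and the second one `φ ⊗_{A^{1/q}} A^{1/q^{n+1}}`. -/
def RelCartierMap.pow (hR : (p : R) = 0) (φ : RelCartierMap h e R L) :
    (n : ℕ) → rootPower L (frob hR e) n →ₗ[R] R ⊗[A] RootRing h (e * n)
  | 0 => (Algebra.TensorProduct.includeLeft : R →ₐ[R] R ⊗[A] RootRing h (e * 0)).toLinearMap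
  | n + 1 =>
    let g : L ⊗[R] rootPower L (frob hR e) n →ₗ[R] (R ⊗[A] RootRing h (e * n)) ⊗[R] L :=
      (TensorProduct.comm R L (R ⊗[A] RootRing h (e * n))).toLinearMap ∘ₗ
        (LinearMap.lTensor L (φ.pow hR n))
    { toFun := fun y => φ.twist (e * n) (g y)
      map_add' := fun y z =>
        (congrArg (φ.twist (e * n)) (g.map_add y z)).trans (map_add _ _ _)
      map_smul' := fun r y =>
        (congrArg (φ.twist (e * n)) (g.map_smul (frob hR e r) y)).trans
          (φ.extend_pow_smul _ _ r _) }

/-- The `n`-th relative non-`F`-pure ideal `σ_n(X/V, φ) ⊆ R_{A^{1/p^{ne}}}` for `X = Spec R` and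
`V = Spec A`, the image of `φ^n`. (The image is already an ideal.) -/
def RelCartierMap.sigma (hR : (p : R) = 0) (φ : RelCartierMap h e R L) (n : ℕ) :
    Ideal (R ⊗[A] RootRing h (e * n)) :=
  Ideal.span (Set.range (φ.pow hR n))

/-! ### Base change -/

section BaseChange

attribute [local instance] Algebra.TensorProduct.rightAlgebra

variable {B : Type u} [CommRing B] [Algebra A B]

/-- The map `A^{1/p^m} → B^{1/p^m}`. -/
def rootMap (h : (p : A) = 0) (hB : (p : B) = 0) (m : ℕ) : RootRing h m →+* RootRing hB m :=
  ((toRoot hB m).toRingHom.comp (algebraMap A B)).comp (toRoot h m).symm.toRingHom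

/-- The map `R_{A^{1/p^m}} = R ⊗_A A^{1/p^m} → (R_B) ⊗_B B^{1/p^m} = (R_B)_{B^{1/p^m}}`. -/
def baseChangeMap (R : Type u) [CommRing R] [Algebra A R] (h : (p : A) = 0) (hB : (p : B) = 0)
    (m : ℕ) : R ⊗[A] RootRing h m →+* (R ⊗[A] B) ⊗[B] RootRing hB m :=
  Algebra.TensorProduct.mapRingHom (algebraMap A B) Algebra.TensorProduct.includeLeftRingHom
    (rootMap h hB m)
    (RingHom.ext fun a => Algebra.TensorProduct.tmul_one_eq_one_tmul a)
    (by ext a; simp [rootMap, algebraMap_root])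

/-- The base change `φ_B : (L_B)^{1/p^e} → (R_B)_{B^{1/p^e}}` of `φ` along `A → B`. -/
def RelCartierMap.baseChange (φ : RelCartierMap h e R L) (hB : (p : B) = 0) :
    RelCartierMap hB e (R ⊗[A] B) ((R ⊗[A] B) ⊗[R] L) :=
  let ν : R ⊗[A] RootRing hB e →+* (R ⊗[A] B) ⊗[B] RootRing hB e :=
    Algebra.TensorProduct.mapRingHom (algebraMap A B) Algebra.TensorProduct.includeLeftRingHom
      (RingHom.id _) (RingHom.ext fun a => Algebra.TensorProduct.tmul_one_eq_one_tmul a)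
      (by ext a; simp [algebraMap_root])
  have hj : ∀ a, algebraMap A (RootRing hB e) a
      = (toRoot hB e).toRingHom (algebraMap A B a) ^ p ^ e := fun a => by
    simp [algebraMap_root]
  have hS : (p : R ⊗[A] B) = 0 := natCast_eq_zero_of_ringHom (algebraMap B (R ⊗[A] B)) hB
  have hν (r : R) (b : B) :
      ν (r ⊗ₜ algebraMap B (RootRing hB e) b) = (r ⊗ₜ[A] b) ⊗ₜ[B] 1 := by
    have : (r ⊗ₜ[A] b : R ⊗[A] B) = b • (r ⊗ₜ[A] 1) := by
      rw [Algebra.smul_def]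
      change _ = (1 ⊗ₜ[A] b) * (r ⊗ₜ[A] 1)
      simp
    rw [this, TensorProduct.smul_tmul, Algebra.smul_def, mul_one]
    simp [ν]
  have key (x : R ⊗[A] B) (y : (R ⊗[A] B) ⊗[R] L) :
      ν (φ.extend (toRoot hB e).toRingHom hj (frob hS e x • y)) =
        (x ⊗ₜ 1) * ν (φ.extend (toRoot hB e).toRingHom hj y) := by
    induction x using TensorProduct.induction_on with
    | zero => simp
    | add x x' hx hx' => rw [map_add, add_smul, map_add, map_add, hx, hx', TensorProduct.add_tmul,
        add_mul]
    | tmul r b =>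
      have h1 : frob hS e (r ⊗ₜ[A] b) = (r ^ p ^ e) ⊗ₜ[A] (b ^ p ^ e) :=
        Algebra.TensorProduct.tmul_pow _ _ _
      rw [h1, extend_smul, map_mul ν, ← hν]
      rfl
  { toFun := ν.toAddMonoidHom.comp (φ.extend (toRoot hB e).toRingHom hj)
    map_pow_smul := key
    map_base_smul := fun b y => by
      have h1 : algebraMap B (R ⊗[A] B) b = ((1 : R) ^ p ^ e) ⊗ₜ[A] b := by
        rw [one_pow]
        rfl
      have h2 := congrArg ν (φ.extend_smul (toRoot hB e).toRingHom hj 1 b y)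
      rw [← h1, map_mul ν] at h2
      refine h2.trans ?_
      congr 1
      simp [ν, Algebra.TensorProduct.one_def] }

end BaseChange

/-! ### Perfect base fields -/

section Perfect

variable {K : Type u} [Field K] [CharP K p] [PerfectField K]

/-- For a perfect field `K` and a `K`-algebra `S`, the identification of
`S_{K^{1/p^m}} = S ⊗_K K^{1/p^m}` with `S`, through `K^{1/p^m} = K`. -/
def perfectIdent (hK : (p : K) = 0) (S : Type u) [CommRing S] [Algebra K S] (m : ℕ) :
    S ⊗[K] RootRing hK m →ₐ[S] S :=
  Algebra.TensorProduct.lift (AlgHom.id S S)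
    ((Algebra.ofId K S).comp ({ (iterateFrobeniusEquiv K p m).symm.toRingHom.comp (toRoot hK m).symm.toRingHom with
        commutes' := fun a => by
          exact (iterateFrobeniusEquiv K p m).symm_apply_apply a }))
    (fun _ _ => .all _ _)

/-- Over a perfect field `K`, a relative map `φ : M^{1/p^e} → S_{K^{1/p^e}}` is identified with
a `p^{-e}`-linear map `ψ : M^{1/p^e} → S`. -/
def RelCartierMap.toCartierMap {hK : (p : K) = 0} {S M : Type u} [CommRing S] [Algebra K S]
    [AddCommGroup M] [Module S M] (φ : RelCartierMap hK e S M) : CartierMap p e S M where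
  toFun := (perfectIdent hK S e).toRingHom.toAddMonoidHom.comp φ.toFun
  map_pow_smul s x := by
    simp [φ.map_pow_smul, perfectIdent]

end Perfect

/-! ### Restriction of `σ_n` to base changes and to perfect fibers -/

section Fiber

attribute [local instance] Algebra.TensorProduct.rightAlgebra

/-- The extension `σ_n(X/V, φ) · 𝒪_{X_{T^{ne}}}` for `T = Spec B → V = Spec A`, the ideal of
`(R_B)_{B^{1/p^{ne}}}` generated by the image of `σ_n(X/V, φ)`. -/
def RelCartierMap.sigmaExtended (hR : (p : R) = 0) (φ : RelCartierMap h e R L)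
    {B : Type u} [CommRing B] [Algebra A B] (hB : (p : B) = 0) (n : ℕ) :
    Ideal ((R ⊗[A] B) ⊗[B] RootRing hB (e * n)) :=
  (φ.sigma hR n).map (baseChangeMap R h hB (e * n))

/-- The relative non-`F`-pure ideal `σ_n(X_T/T, φ_T)` of the base change to `T = Spec B`. -/
def RelCartierMap.sigmaBaseChange (φ : RelCartierMap h e R L)
    {B : Type u} [CommRing B] [Algebra A B] (hB : (p : B) = 0) (n : ℕ) :
    Ideal ((R ⊗[A] B) ⊗[B] RootRing hB (e * n)) :=
  (φ.baseChange hB).sigma (natCast_eq_zero_of_ringHom (algebraMap B (R ⊗[A] B)) hB) n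

variable (K : Type u) [Field K] [CharP K p] [PerfectField K] [Algebra A K]

/-- For a perfect point `s = Spec K → V = Spec A`, the ideal `σ_n(X/V, φ) · 𝒪_{X_{s^{ne}}}`
as an ideal of `𝒪_{X_s} = R ⊗_A K`, through the identification of `X_{s^{ne}}` with `X_s`. -/
def RelCartierMap.sigmaOnFiber (hR : (p : R) = 0) (φ : RelCartierMap h e R L) (n : ℕ) :
    Ideal (R ⊗[A] K) :=
  (φ.sigmaExtended hR (CharP.cast_eq_zero K p) n).map
    (perfectIdent (CharP.cast_eq_zero K p) (R ⊗[A] K) (e * n))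

/-- The `p^{-e}`-linear map `ψ_s : (L_s)^{1/p^e} → 𝒪_{X_s}` induced by `φ` on the fiber over
a perfect point `s = Spec K → V = Spec A`: the base change `φ_s`, with `K^{1/p^e}` identified
with `K`. Here `L_s = 𝒪_{X_s} ⊗_R L`. -/
def RelCartierMap.fiberMap (φ : RelCartierMap h e R L) :
    CartierMap p e (R ⊗[A] K) ((R ⊗[A] K) ⊗[R] L) :=
  (φ.baseChange (CharP.cast_eq_zero K p)).toCartierMap

/-- The absolute non-`F`-pure ideal `σ(X_s, ψ_s)` of the fiber over a perfect point. -/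
def RelCartierMap.fiberSigma (φ : RelCartierMap h e R L) : Ideal (R ⊗[A] K) :=
  (φ.fiberMap K).sigma (natCast_eq_zero_of_ringHom (algebraMap K (R ⊗[A] K))
    (CharP.cast_eq_zero K p))

end Fiber

end Relative


/-! ## Frobenius morphisms of schemes -/

section Schemes

theorem natCast_section {p : ℕ} {X : Scheme.{u}} (hX : (p : Γ(X, ⊤)) = 0) (U : X.Opens) :
    (p : Γ(X, U)) = 0 :=
  natCast_eq_zero_of_ringHom (X.presheaf.map (homOfLE le_top).op).hom hX

theorem natCast_source {p : ℕ} {X V : Scheme.{u}} (f : X ⟶ V) (hV : (p : Γ(V, ⊤)) = 0) :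
    (p : Γ(X, ⊤)) = 0 :=
  natCast_eq_zero_of_ringHom f.appTop.hom hV

variable {p : ℕ} [Fact p.Prime]

/-- The `e`-th absolute Frobenius of a scheme of characteristic `p`: the identity on points,
and `x ↦ x ^ (p ^ e)` on functions. -/
def absFrobenius {X : Scheme.{u}} (hX : (p : Γ(X, ⊤)) = 0) (e : ℕ) : X ⟶ X where
  base := 𝟙 _
  c :=
    { app := fun U => CommRingCat.ofHom (frob (natCast_section hX U.unop) e)
      naturality := fun U V i => by
        ext x
        exact (map_pow (X.presheaf.map i).hom x (p ^ e)).symm }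
  prop := fun x => by
    constructor
    intro a ha
    obtain ⟨U, hxU, s, rfl⟩ := X.presheaf.exists_germ_eq a
    erw [PresheafedSpace.stalkMap_germ_apply] at ha
    have hq : p ^ e ≠ 0 := pow_ne_zero _ (Fact.out : p.Prime).ne_zero
    have h1 : IsUnit ((X.presheaf.germ U x hxU).hom s ^ p ^ e) := by
      rw [← map_pow]
      exact ha
    exact (isUnit_pow_iff hq).1 h1

theorem absFrobenius_appLE {X : Scheme.{u}} (hX : (p : Γ(X, ⊤)) = 0) (e : ℕ) (U U' : X.Opens)
    (hU : U' ≤ absFrobenius hX e ⁻¹ᵁ U) (x : Γ(X, U)) :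
    (absFrobenius hX e).appLE U U' hU x = X.presheaf.map (homOfLE hU).op (x ^ p ^ e) := rfl

variable {X V : Scheme.{u}} (f : X ⟶ V)

theorem absFrobenius_comp (hV : (p : Γ(V, ⊤)) = 0) (e : ℕ) :
    absFrobenius (natCast_source f hV) e ≫ f = f ≫ absFrobenius hV e := by
  refine Scheme.Hom.ext rfl fun U => ?_
  ext x
  have h1 : (X.presheaf.map (𝟙 (Opposite.op (f ⁻¹ᵁ U)))).hom ((f.app U).hom x ^ p ^ e) =
      (f.app U).hom (x ^ p ^ e) := by
    rw [X.presheaf.map_id, map_pow (f.app U).hom]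
    rfl
  exact h1

/-- The scheme `X_{V^e} = X ×_V V^e`, where `V^e` is `V` viewed over itself through the `e`-th
absolute Frobenius. -/
abbrev frobTwist (hV : (p : Γ(V, ⊤)) = 0) (e : ℕ) : Scheme.{u} :=
  pullback f (absFrobenius hV e)

/-- The `e`-th relative Frobenius `X^e → X_{V^e}`. -/
def relFrobenius (hV : (p : Γ(V, ⊤)) = 0) (e : ℕ) : X ⟶ frobTwist f hV e :=
  pullback.lift (absFrobenius (natCast_source f hV) e) f (absFrobenius_comp f hV e)

/-- An `𝒪_X`-module is a line bundle if it is locally isomorphic to `𝒪_X`. -/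
def IsLineBundle (L : X.Modules) : Prop :=
  ∀ x : X, ∃ U : X.Opens, x ∈ U ∧
    Nonempty (L.restrict U.ι ≅ (SheafOfModules.unit U.toScheme.ringCatSheaf : U.toScheme.Modules))

/-- The type of `𝒪_{X_{V^e}}`-linear maps `φ : L^{1/p^e} → 𝒪_{X_{V^e}}`, where `L^{1/p^e}` is the
direct image of `L` under the relative Frobenius. -/
def RelMap (hV : (p : Γ(V, ⊤)) = 0) (e : ℕ) (L : X.Modules) : Type u :=
  (Scheme.Modules.pushforward (relFrobenius f hV e)).obj L ⟶
    (SheafOfModules.unit (frobTwist f hV e).ringCatSheaf : (frobTwist f hV e).Modules)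

/-- Affine open sets `U ⊆ X` and `W ⊆ V` with `f(U) ⊆ W`. -/
structure Chart where
  /-- the open subset of `X` -/
  U : X.Opens
  /-- the open subset of `V` -/
  W : V.Opens
  affine_U : IsAffineOpen U
  affine_W : IsAffineOpen W
  le : U ≤ f ⁻¹ᵁ W

namespace Chart

variable {f} (c : Chart f)

/-- The ring `A = 𝒪_V(W)`. -/
def A : Type u := Γ(V, c.W)

/-- The ring `R = 𝒪_X(U)`. -/
def R : Type u := Γ(X, c.U)

instance : CommRing c.A := inferInstanceAs (CommRing Γ(V, c.W))
instance : CommRing c.R := inferInstanceAs (CommRing Γ(X, c.U))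
instance : Algebra c.A c.R := (f.appLE c.W c.U c.le).hom.toAlgebra

/-- The `R`-module `L(U)`. -/
def Sec (L : X.Modules) : Type u := Γ(L, c.U)

instance (L : X.Modules) : AddCommGroup (c.Sec L) := inferInstanceAs (AddCommGroup Γ(L, c.U))
instance (L : X.Modules) : Module c.R (c.Sec L) := inferInstanceAs (Module Γ(X, c.U) Γ(L, c.U))

end Chart

end Schemes

section Local

variable {X V : Scheme.{u}} {f : X ⟶ V}

namespace Chart

theorem natCast_A {p : ℕ} (c : Chart f) (hV : (p : Γ(V, ⊤)) = 0) : (p : c.A) = 0 :=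
  natCast_section hV c.W

theorem natCast_R {p : ℕ} (c : Chart f) (hV : (p : Γ(V, ⊤)) = 0) : (p : c.R) = 0 :=
  natCast_section (natCast_source f hV) c.U

variable {p : ℕ} [Fact p.Prime] (c : Chart f) (hV : (p : Γ(V, ⊤)) = 0) (e : ℕ)

/-- The affine open subset `U ×_W W^e` of `X_{V^e}`. -/
def twistOpen : (frobTwist f hV e).Opens :=
  pullback.fst f (absFrobenius hV e) ⁻¹ᵁ c.U ⊓ pullback.snd f (absFrobenius hV e) ⁻¹ᵁ c.W

/-- The map from `R` to the functions on `U ×_W W^e`. -/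
def twistFst : CommRingCat.of c.R ⟶ Γ(frobTwist f hV e, c.twistOpen hV e) :=
  (pullback.fst f (absFrobenius hV e)).appLE c.U (c.twistOpen hV e) inf_le_left

/-- The map from `A^{1/p^e}` to the functions on `U ×_W W^e`. -/
def twistSnd : CommRingCat.of (RootRing (c.natCast_A hV) e) ⟶
    Γ(frobTwist f hV e, c.twistOpen hV e) :=
  (pullback.snd f (absFrobenius hV e)).appLE c.W (c.twistOpen hV e) inf_le_right

theorem isPushout : IsPushout (CommRingCat.ofHom (algebraMap c.A c.R))
    (CommRingCat.ofHom (algebraMap c.A (RootRing (c.natCast_A hV) e)))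
    (c.twistFst hV e) (c.twistSnd hV e) := by
  have h1 : (absFrobenius hV e).appLE c.W c.W le_rfl =
      CommRingCat.ofHom (algebraMap c.A (RootRing (c.natCast_A hV) e)) := by
    ext x
    have h2 : (V.presheaf.map (𝟙 (Opposite.op c.W))).hom (x ^ p ^ e) = x ^ p ^ e := by
      rw [V.presheaf.map_id]
      rfl
    exact h2
  have h3 := h1 ▸ (isIso_pushoutSection_iff (.of_hasPullback f (absFrobenius hV e)) le_rfl c.le rfl).1
    (isIso_pushoutSection_of_isAffineOpen _ _ _ _ c.affine_W c.affine_W c.affine_U)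
  exact h3

/-- The isomorphism between `R_{A^{1/p^e}} = R ⊗_A A^{1/p^e}` and the ring of functions on
`U ×_W W^e`. -/
def twistEquiv : c.R ⊗[c.A] RootRing (c.natCast_A hV) e ≃+*
    Γ(frobTwist f hV e, c.twistOpen hV e) :=
  ((CommRingCat.isPushout_tensorProduct c.A c.R (RootRing (c.natCast_A hV) e)).isoIsPushout _ _
    (c.isPushout hV e)).commRingCatIsoToRingEquiv

theorem twistEquiv_left (r : c.R) : c.twistEquiv hV e (r ⊗ₜ 1) = c.twistFst hV e r :=
  congr($((CommRingCat.isPushout_tensorProduct c.A c.R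
    (RootRing (c.natCast_A hV) e)).inl_isoIsPushout_hom _ _ (c.isPushout hV e)) r)

theorem twistEquiv_right (a : RootRing (c.natCast_A hV) e) : c.twistEquiv hV e (1 ⊗ₜ a) =
    c.twistSnd hV e a :=
  congr($((CommRingCat.isPushout_tensorProduct c.A c.R
    (RootRing (c.natCast_A hV) e)).inr_isoIsPushout_hom _ _ (c.isPushout hV e)) a)

theorem preimage_twistOpen_le : relFrobenius f hV e ⁻¹ᵁ c.twistOpen hV e ≤ c.U := by
  have h1 : relFrobenius f hV e ≫ pullback.fst f (absFrobenius hV e) =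
    absFrobenius (natCast_source f hV) e := pullback.lift_fst _ _ _
  intro x hx
  have h2 : (relFrobenius f hV e ≫ pullback.fst f (absFrobenius hV e)) x ∈ c.U := hx.1
  rw [h1] at h2
  exact h2

theorem le_preimage_twistOpen : c.U ≤ relFrobenius f hV e ⁻¹ᵁ c.twistOpen hV e := by
  have h1 : relFrobenius f hV e ≫ pullback.fst f (absFrobenius hV e) =
    absFrobenius (natCast_source f hV) e := pullback.lift_fst _ _ _
  have h2 : relFrobenius f hV e ≫ pullback.snd f (absFrobenius hV e) = f :=
    pullback.lift_snd _ _ _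
  intro x hx
  refine ⟨?_, ?_⟩
  · change (relFrobenius f hV e ≫ pullback.fst f (absFrobenius hV e)) x ∈ c.U
    rw [h1]
    exact hx
  · change (relFrobenius f hV e ≫ pullback.snd f (absFrobenius hV e)) x ∈ c.W
    rw [h2]
    exact c.le hx

/-- The map `φ` on the affine open set `U ×_W W^e`, as an `R_{A^{1/p^e}}`-linear map
`L(U)^{1/p^e} → R_{A^{1/p^e}}`. -/
def localMap {L : X.Modules} (φ : RelMap f hV e L) :
    RelCartierMap (c.natCast_A hV) e c.R (c.Sec L) :=
  let ρ : Γ(L, c.U) →+ Γ(L, relFrobenius f hV e ⁻¹ᵁ c.twistOpen hV e) :=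
    (L.presheaf.map (homOfLE (c.preimage_twistOpen_le hV e)).op).hom
  let φ' : Γ(L, relFrobenius f hV e ⁻¹ᵁ c.twistOpen hV e) →+
      Γ(frobTwist f hV e, c.twistOpen hV e) :=
    (Scheme.Modules.Hom.app φ (c.twistOpen hV e)).hom
  have key (x : Γ(frobTwist f hV e, c.twistOpen hV e)) (r : Γ(X, c.U))
      (hx : (relFrobenius f hV e).app (c.twistOpen hV e) x =
        X.presheaf.map (homOfLE (c.preimage_twistOpen_le hV e)).op r) (l : Γ(L, c.U)) :
      φ' (ρ (r • l)) = x * φ' (ρ l) := by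
    have h1 : ρ (r • l) = (relFrobenius f hV e).app (c.twistOpen hV e) x • ρ l :=
      (Scheme.Modules.map_smul L _ r l).trans (by rw [hx])
    rw [h1]
    exact Scheme.Modules.Hom.app_smul φ x _
  { toFun := (c.twistEquiv hV e).symm.toRingHom.toAddMonoidHom.comp (φ'.comp ρ)
    map_pow_smul := fun r l => by
      have h1 : relFrobenius f hV e ≫ pullback.fst f (absFrobenius hV e) =
        absFrobenius (natCast_source f hV) e := pullback.lift_fst _ _ _
      have h2 := key (c.twistFst hV e r) (r ^ p ^ e) (by
        have h3 := Scheme.Hom.appLE_comp_appLE (relFrobenius f hV e)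
          (pullback.fst f (absFrobenius hV e)) c.U (c.twistOpen hV e)
          (relFrobenius f hV e ⁻¹ᵁ c.twistOpen hV e) inf_le_left le_rfl
        rw [Scheme.Hom.appLE_eq_app] at h3
        refine congr($h3 r).trans ?_
        simp only [h1]
        rfl) l
      change (c.twistEquiv hV e).symm (φ' (ρ _)) = _ * (c.twistEquiv hV e).symm (φ' (ρ _))
      refine (congrArg _ h2).trans ?_
      rw [map_mul, ← c.twistEquiv_left, RingEquiv.symm_apply_apply]
    map_base_smul := fun a l => by
      have h1 : relFrobenius f hV e ≫ pullback.snd f (absFrobenius hV e) = f :=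
        pullback.lift_snd _ _ _
      have h2 := key (c.twistSnd hV e (toRoot (c.natCast_A hV) e a)) (algebraMap c.A c.R a) (by
        have h3 := Scheme.Hom.appLE_comp_appLE (relFrobenius f hV e)
          (pullback.snd f (absFrobenius hV e)) c.W (c.twistOpen hV e)
          (relFrobenius f hV e ⁻¹ᵁ c.twistOpen hV e) inf_le_right le_rfl
        rw [Scheme.Hom.appLE_eq_app] at h3
        refine congr($h3 a).trans ?_
        simp only [h1]
        exact congr($(Scheme.Hom.appLE_map f c.le
          (homOfLE (c.preimage_twistOpen_le hV e)).op) a).symm) l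
      change (c.twistEquiv hV e).symm (φ' (ρ _)) = _ * (c.twistEquiv hV e).symm (φ' (ρ _))
      refine (congrArg _ h2).trans ?_
      rw [map_mul, ← c.twistEquiv_right, RingEquiv.symm_apply_apply] }

/-- The `A`-algebra structure on `𝒪_T(O)`, for a morphism `g : T → V` and an open set `O`
of `T` that maps to `W`. -/
abbrev baseAlgebra {T : Scheme.{u}} (g : T ⟶ V) (O : T.Opens) (hO : O ≤ g ⁻¹ᵁ c.W) :
    Algebra c.A Γ(T, O) :=
  (g.appLE c.W O hO).hom.toAlgebra

/-- The `A`-algebra structure on `K`, for a point `s : Spec K → V` that maps to `W`. -/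
abbrev pointAlgebra {K : Type u} [Field K] (s : Spec (.of K) ⟶ V) (hs : ⊤ ≤ s ⁻¹ᵁ c.W) :
    Algebra c.A K :=
  (s.appLE c.W ⊤ hs ≫ (Scheme.ΓSpecIso (.of K)).hom).hom.toAlgebra

end Chart

end Local

end
end RelFPure

namespace RelFPure

noncomputable section

/-! ## Stabilization of the images of the iterates of a `p^{-e}`-linear map -/

section Stabilization

variable {p e : ℕ} {S M : Type u} [CommRing S] [AddCommGroup M] [Module S M]

/-! On an affine chart `Spec R → Spec A`, put `q = p^e`. Part (2) is an induction on `n`: `σ_{n+1}`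
is generated by the twists of `σ_n`, images of generators generate the image after any base change,
and the twist is linear over the `q^{n+1}`-th roots of the base (`RelCartierMap.sigmaExtended_eq`).
No flatness enters, since only images and no kernels are compared.

For (1), the image of `ψ_s^n` is obtained from the unit ideal by applying `I ↦ ψ_s(I M)` `n` times.
By (2) and `K^{1/q^n} = K`, this is `σ_n` restricted to the fiber
(`RelCartierMap.sigmaOnFiber_eq_iter`). The ideals descend, and one equality of consecutive terms
makes all later terms equal. So an `N` is needed at which the chains of all perfect fibers have
become constant.

A single chain stabilizes over a Noetherian ring (`CartierMap.exists_iter_le_succ`): the colon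
ideals of consecutive terms increase to some `J`. If `J` is proper, localizing at a minimal prime of
`J` leads to a module of finite length, where the chain must stop; this contradicts the choice of
`J`.

Uniformity comes from Noetherian induction on closed subsets of `Spec A`. At a prime `P`,
stabilization is applied over the fraction field of the perfect closure `D` of `A/P`. Since `σ_N` is
finitely generated already over a root of `A`, the resulting inclusion spreads out to `D` after
multiplication by a nonzero element of `D`, a power of which comes from some `a ∉ P`. Every perfect
point of `V(P)` with `a ≠ 0` receives a map from `D` and inherits the inclusion
(`RelCartierMap.exists_stable_of_prime`). The remaining points lie in a smaller closed set.

Finally `X` is covered by finitely many charts. Formation of the chains commutes with passing to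
basic open subsets of source and base, so stability on a fiber is local and transfers from the cover
to an arbitrary chart (`Chart.stableAt_of_cover`). -/

/-- The ideal `ψ(I M)`. -/
def CartierMap.mapIdeal (ψ : CartierMap p e S M) (I : Ideal S) : Ideal S where
  carrier := {s | ∃ x ∈ I • (⊤ : Submodule S M), ψ.toFun x = s}
  zero_mem' := ⟨0, zero_mem _, map_zero _⟩
  add_mem' := by
    rintro _ _ ⟨x, hx, rfl⟩ ⟨y, hy, rfl⟩
    exact ⟨x + y, add_mem hx hy, map_add _ _ _⟩
  smul_mem' := by
    rintro s _ ⟨x, hx, rfl⟩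
    exact ⟨s ^ p ^ e • x, Submodule.smul_mem _ _ hx, ψ.map_pow_smul s x⟩

theorem CartierMap.mapIdeal_mono (ψ : CartierMap p e S M) {I J : Ideal S} (h : I ≤ J) :
    ψ.mapIdeal I ≤ ψ.mapIdeal J := by
  rintro _ ⟨x, hx, rfl⟩
  exact ⟨x, Submodule.smul_mono_left h hx, rfl⟩

/-- An ideal containing all `ψ(a m)` with `a ∈ I` contains `ψ(I M)`. -/
theorem CartierMap.mapIdeal_le {ψ : CartierMap p e S M} {I J : Ideal S}
    (h : ∀ a ∈ I, ∀ m : M, ψ.toFun (a • m) ∈ J) : ψ.mapIdeal I ≤ J := by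
  rintro _ ⟨x, hx, rfl⟩
  induction hx using Submodule.smul_induction_on' with
  | smul a ha m _ => exact h a ha m
  | add x _ y _ hx hy => rw [map_add]; exact add_mem hx hy

theorem CartierMap.apply_smul_mem_mapIdeal (ψ : CartierMap p e S M) {I : Ideal S} {a : S}
    (ha : a ∈ I) (m : M) : ψ.toFun (a • m) ∈ ψ.mapIdeal I :=
  ⟨_, Submodule.smul_mem_smul ha trivial, rfl⟩

/-- The ideals `S ⊇ ψ(M) ⊇ ψ(ψ(M) M) ⊇ ⋯`. -/
def CartierMap.iter (ψ : CartierMap p e S M) (n : ℕ) : Ideal S := ψ.mapIdeal^[n] ⊤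

theorem CartierMap.iter_zero (ψ : CartierMap p e S M) : ψ.iter 0 = ⊤ := rfl

theorem CartierMap.iter_succ (ψ : CartierMap p e S M) (n : ℕ) :
    ψ.iter (n + 1) = ψ.mapIdeal (ψ.iter n) := Function.iterate_succ_apply' _ _ _

theorem CartierMap.iter_succ_le (ψ : CartierMap p e S M) (n : ℕ) :
    ψ.iter (n + 1) ≤ ψ.iter n := by
  induction n with
  | zero => exact le_top
  | succ n ih =>
    rw [ψ.iter_succ (n + 1)]
    exact (ψ.mapIdeal_mono ih).trans (ψ.iter_succ n).ge

theorem CartierMap.iter_antitone (ψ : CartierMap p e S M) : Antitone ψ.iter :=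
  antitone_nat_of_succ_le ψ.iter_succ_le

theorem CartierMap.iter_eq_of_eq_succ (ψ : CartierMap p e S M) {N : ℕ}
    (hN : ψ.iter N ≤ ψ.iter (N + 1)) {n : ℕ} (hn : N ≤ n) : ψ.iter n = ψ.iter N := by
  induction n, hn using Nat.le_induction with
  | base => rfl
  | succ n hn ih =>
    rw [ψ.iter_succ, ih, ← ψ.iter_succ]
    exact le_antisymm (ψ.iter_succ_le N) hN

/-- Since `s ψ(a m) = ψ(s^q a m)` with `q = p^e`, a multiplier `s^q` at one level becomes the
multiplier `s` one level further. This gain drives both colon arguments below. -/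
theorem CartierMap.smul_mem_iter_succ (ψ : CartierMap p e S M) {n k : ℕ} {s : S}
    (hs : ∀ x ∈ ψ.iter n, s ^ p ^ e * x ∈ ψ.iter k) :
    ∀ x ∈ ψ.iter (n + 1), s * x ∈ ψ.iter (k + 1) := by
  intro x hx
  rw [ψ.iter_succ] at hx ⊢
  have : ψ.mapIdeal (ψ.iter n) ≤ Submodule.comap (LinearMap.mulLeft S s) (ψ.mapIdeal (ψ.iter k)) := by
    refine CartierMap.mapIdeal_le fun a ha m => ?_
    change s * ψ.toFun (a • m) ∈ ψ.mapIdeal (ψ.iter k)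
    rw [← ψ.map_pow_smul, smul_smul]
    exact ψ.apply_smul_mem_mapIdeal (hs a ha) m
  exact this hx

variable [Fact p.Prime]

theorem CartierMap.range_pow_zero (h : (p : S) = 0) (ψ : CartierMap p e S M) :
    LinearMap.range (ψ.pow h 0) = (⊤ : Ideal S) :=
  LinearMap.range_eq_top.2 fun x => ⟨x, rfl⟩

theorem CartierMap.pow_succ_tmul (h : (p : S) = 0) (ψ : CartierMap p e S M) (n : ℕ) (m : M)
    (y : rootPower M (frob h e) n) :
    ψ.pow h (n + 1) (m ⊗ₜ[S] y : M ⊗[S] rootPower M (frob h e) n) =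
      ψ.toFun (ψ.pow h n y • m) := by
  rfl

/-- The twisted tensor power enters the image of `ψ^{n+1}` only through the ideal `Im ψ^n`, so
afterwards only ideals of `S` have to be iterated. -/
theorem CartierMap.range_pow_succ (h : (p : S) = 0) (ψ : CartierMap p e S M) (n : ℕ) :
    LinearMap.range (ψ.pow h (n + 1)) = ψ.mapIdeal (LinearMap.range (ψ.pow h n)) := by
  apply le_antisymm
  · rintro _ ⟨y, rfl⟩
    change M ⊗[S] rootPower M (frob h e) n at y
    induction y using TensorProduct.induction_on with
    | zero => exact (map_zero (ψ.pow h (n + 1))).symm ▸ zero_mem _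
    | tmul m y =>
      rw [pow_succ_tmul]
      exact ψ.apply_smul_mem_mapIdeal (LinearMap.mem_range_self _ y) m
    | add x y hx hy =>
      exact (map_add (ψ.pow h (n + 1)) x y).symm ▸ add_mem hx hy
  · refine CartierMap.mapIdeal_le ?_
    rintro _ ⟨y, rfl⟩ m
    exact ⟨(m ⊗ₜ[S] y : M ⊗[S] rootPower M (frob h e) n), ψ.pow_succ_tmul h n m y⟩

theorem CartierMap.range_pow (h : (p : S) = 0) (ψ : CartierMap p e S M) (n : ℕ) :
    LinearMap.range (ψ.pow h n) = ψ.iter n := by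
  induction n with
  | zero => exact ψ.range_pow_zero h
  | succ n ih => rw [range_pow_succ, ih, iter_succ]

theorem CartierMap.sigma_eq_iter (h : (p : S) = 0) (ψ : CartierMap p e S M) {N : ℕ}
    (hN : ψ.iter N ≤ ψ.iter (N + 1)) {n : ℕ} (hn : N ≤ n) : ψ.sigma h = ψ.iter n := by
  rw [CartierMap.sigma]
  simp_rw [range_pow]
  refine le_antisymm (iInf_le _ n) (le_iInf fun k => ?_)
  rcases le_total k n with hk | hk
  · exact ψ.iter_antitone hk
  · rw [ψ.iter_eq_of_eq_succ hN hn, ψ.iter_eq_of_eq_succ hN (hn.trans hk)]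

/-- The ascending chain of ideals `(ψ^{n+1}(M) : ψ^n(M))`. -/
def CartierMap.colonChain (ψ : CartierMap p e S M) : ℕ →o Ideal S where
  toFun n := (ψ.iter (n + 1)).colon (ψ.iter n : Set S)
  monotone' := monotone_nat_of_le_succ fun n s hs => by
    rw [Submodule.mem_colon] at hs ⊢
    refine ψ.smul_mem_iter_succ fun x hx => ?_
    have hq : p ^ e ≠ 0 := pow_ne_zero _ (Fact.out : p.Prime).ne_zero
    obtain ⟨k, hk⟩ := Nat.exists_eq_succ_of_ne_zero hq
    rw [hk, pow_succ, mul_assoc]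
    exact Ideal.mul_mem_left _ _ (hs x hx)

theorem CartierMap.mem_colonChain (ψ : CartierMap p e S M) {n : ℕ} {s : S} :
    s ∈ ψ.colonChain n ↔ ∀ x ∈ ψ.iter n, s * x ∈ ψ.iter (n + 1) :=
  Submodule.mem_colon

/-- One factor `s` moves `x` into `ψ.iter (N + 1)`; the other enters `ψ` as `s^q`, which is
divisible by `s^2` because `e > 0`, so the induction hypothesis applies inside `ψ`. Hence the
exponent `2` does not grow with `n`. -/
theorem CartierMap.sq_mul_mem_iter (he : 0 < e) (ψ : CartierMap p e S M) {N : ℕ} {s : S}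
    (hs : s ∈ ψ.colonChain N) (n : ℕ) (hn : N ≤ n) :
    ∀ x ∈ ψ.iter N, s ^ 2 * x ∈ ψ.iter n := by
  induction n, hn using Nat.le_induction with
  | base => exact fun x hx => Ideal.mul_mem_left _ _ hx
  | succ n hn ih =>
    intro x hx
    rw [pow_two, mul_assoc]
    refine ψ.smul_mem_iter_succ (n := N) (fun y hy => ?_) _ ((ψ.mem_colonChain).1 hs x hx)
    have hq : 2 ≤ p ^ e := (Fact.out : p.Prime).two_le.trans (Nat.le_self_pow he.ne' p)
    obtain ⟨k, hk⟩ := Nat.exists_eq_add_of_le hq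
    rw [hk, add_comm, pow_add, mul_assoc]
    exact Ideal.mul_mem_left _ _ (ih y hy)

/-- All terms lie between `a I₀` and `I₀`, so the chain is determined by its image in `I₀ / a I₀`, a
finite module over the Artinian ring `R / a`. -/
theorem _root_.Ideal.exists_eq_succ_of_mul_le {R : Type u} [CommRing R] [IsNoetherianRing R]
    (a : Ideal R) [IsArtinianRing (R ⧸ a)] (I : ℕ → Ideal R) (hI : Antitone I)
    (ha : ∀ n, a * I 0 ≤ I n) : ∃ n, I n ≤ I (n + 1) := by
  let Q := I 0 ⧸ (a • ⊤ : Submodule R (I 0))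
  have : Module.Finite (R ⧸ a) Q := Module.Finite.of_restrictScalars_finite R _ _
  have hQ : IsArtinian (R ⧸ a) Q := inferInstance
  have : RingHomSurjective (Ideal.Quotient.mk a) := ⟨Ideal.Quotient.mk_surjective⟩
  let l : Q →ₛₗ[Ideal.Quotient.mk a] Q :=
    { toFun := id, map_add' := fun _ _ => rfl, map_smul' := fun _ _ => rfl }
  have hQ' : IsArtinian R Q := (l.isArtinian_iff_of_bijective Function.bijective_id).2 hQ
  let T : ℕ →o (Submodule R Q)ᵒᵈ :=
    { toFun := fun n => OrderDual.toDual
        ((Submodule.comap (I 0).subtype (I n)).map (Submodule.mkQ (a • ⊤ : Submodule R (I 0))))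
      monotone' := fun m n hmn => Submodule.map_mono (Submodule.comap_mono (hI hmn)) }
  obtain ⟨n, hn⟩ := IsArtinian.monotone_stabilizes T
  refine ⟨n, fun x hx => ?_⟩
  have hx0 : x ∈ I 0 := hI (Nat.zero_le n) hx
  have h1 : Submodule.mkQ (a • ⊤ : Submodule R (I 0)) ⟨x, hx0⟩ ∈
      (Submodule.comap (I 0).subtype (I n)).map (Submodule.mkQ (a • ⊤ : Submodule R (I 0))) :=
    Submodule.mem_map_of_mem hx
  have h2 : (Submodule.comap (I 0).subtype (I n)).map (Submodule.mkQ (a • ⊤ : Submodule R (I 0))) =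
      (Submodule.comap (I 0).subtype (I (n + 1))).map (Submodule.mkQ (a • ⊤ : Submodule R (I 0))) :=
    hn (n + 1) n.le_succ
  rw [h2, ← Submodule.mem_comap, Submodule.comap_map_mkQ] at h1
  refine (sup_le ?_ le_rfl : _ ≤ Submodule.comap (I 0).subtype (I (n + 1))) h1
  rw [Submodule.smul_le]
  exact fun r hr y _ => ha (n + 1) (Ideal.mul_mem_mul hr y.2)

/-- The Hartshorne–Speiser–Lyubeznik–Gabber theorem. -/
theorem CartierMap.exists_iter_le_succ [IsNoetherianRing S] (he : 0 < e)
    (ψ : CartierMap p e S M) : ∃ N, ψ.iter N ≤ ψ.iter (N + 1) := by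
  obtain ⟨N, hN⟩ := monotone_stabilizes_iff_noetherian.2 (inferInstance : IsNoetherian S S)
    ψ.colonChain
  set J := ψ.colonChain N
  by_cases hJtop : J = ⊤
  · refine ⟨N, fun x hx => ?_⟩
    simpa using ψ.mem_colonChain.1 (hJtop ▸ trivial : (1 : S) ∈ J) x hx
  exfalso
  -- Localizing at a minimal prime of `J` makes the powers of `J` primary to the maximal ideal.
  obtain ⟨P, hP⟩ := Ideal.nonempty_minimalPrimes hJtop
  have hPp : P.IsPrime := hP.1.1
  obtain ⟨k, hk⟩ : ∃ k, J ^ k ≤ ⨅ n, (ψ.iter (N + n)).colon (ψ.iter N : Set S) := by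
    refine Ideal.exists_pow_le_of_le_radical_of_fg (fun s hs => ⟨2, ?_⟩) (IsNoetherian.noetherian J)
    rw [Submodule.mem_iInf]
    exact fun n => Submodule.mem_colon.2 (ψ.sq_mul_mem_iter he hs (N + n) (Nat.le_add_right _ _))
  let T := Localization.AtPrime P
  -- The exponent is `k + 1` because `k` may be zero, and a nonzero power is needed to have the same
  -- radical as `J`.
  have hmin : IsLocalRing.maximalIdeal T ∈ ((J ^ (k + 1)).map (algebraMap S T)).minimalPrimes := by
    rw [IsLocalization.minimalPrimes_map P.primeCompl T, Set.mem_preimage,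
      Localization.AtPrime.under_maximalIdeal, ← Ideal.radical_minimalPrimes,
      Ideal.radical_pow _ k.succ_ne_zero, Ideal.radical_minimalPrimes]
    exact hP
  have := IsLocalRing.quotient_artinian_of_mem_minimalPrimes_of_isLocalRing _ hmin
  obtain ⟨n, hn⟩ := Ideal.exists_eq_succ_of_mul_le ((J ^ (k + 1)).map (algebraMap S T))
    (fun n => (ψ.iter (N + n)).map (algebraMap S T))
    (fun m n hmn => Ideal.map_mono (ψ.iter_antitone (Nat.add_le_add_left hmn N))) (fun n => by
      rw [← Ideal.map_mul]
      refine Ideal.map_mono (Ideal.mul_le.2 fun r hr s hs => ?_)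
      exact Submodule.mem_colon.1 ((Submodule.mem_iInf _).1 (hk (Ideal.pow_le_pow_right
        k.le_succ hr)) n) s hs)
  obtain ⟨G, hG⟩ := IsNoetherian.noetherian (ψ.iter (N + n))
  have h1 (x : S) (hx : x ∈ ψ.iter (N + n)) : ∃ s ∉ P, s * x ∈ ψ.iter (N + n + 1) :=
    (IsLocalization.algebraMap_mem_map_algebraMap_iff P.primeCompl T _ x).1
      (hn (Ideal.mem_map_of_mem _ hx))
  choose! s hs hs' using h1
  -- Clearing denominators on finitely many generators puts the product into the colon ideal at
  -- level `N + n`, which is `J ⊆ P`, although no factor lies in `P`.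
  have h2 : ∏ x ∈ G, s x ∈ J := by
    rw [hN (N + n) (Nat.le_add_right _ _), ψ.mem_colonChain]
    have : ψ.iter (N + n) ≤ Submodule.comap (LinearMap.mulLeft S (∏ x ∈ G, s x))
        (ψ.iter (N + n + 1)) := by
      conv_lhs => rw [← hG]
      refine Submodule.span_le.2 fun x hx => ?_
      obtain ⟨c, hc⟩ := Finset.dvd_prod_of_mem s hx
      change (∏ x ∈ G, s x) * x ∈ ψ.iter (N + n + 1)
      rw [hc, mul_comm (s x), mul_assoc]
      exact Ideal.mul_mem_left _ _ (hs' x (hG ▸ Submodule.subset_span hx))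
    exact this
  obtain ⟨x, hx, hxP⟩ := (hPp.prod_mem_iff).1 (hP.1.2 h2)
  exact hs x (hG ▸ Submodule.subset_span hx) hxP

end Stabilization

end

end RelFPure

namespace RelFPure

noncomputable section

/-! ## Images of iterated relative maps and base change -/

section Relative

variable {p : ℕ} [Fact p.Prime] {A : Type u} [CommRing A] {h : (p : A) = 0} {e : ℕ}
  {R L : Type u} [CommRing R] [Algebra A R] [AddCommGroup L] [Module R L]

theorem RelCartierMap.pow_succ_tmul (hR : (p : R) = 0) (φ : RelCartierMap h e R L) (n : ℕ) (l : L)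
    (y : rootPower L (frob hR e) n) :
    φ.pow hR (n + 1) (l ⊗ₜ[R] y : L ⊗[R] rootPower L (frob hR e) n) =
      φ.twist (e * n) (φ.pow hR n y ⊗ₜ[R] l) := rfl

theorem RelCartierMap.twist_smul (φ : RelCartierMap h e R L) (m : ℕ) (r : R) (a : A)
    (y : (R ⊗[A] RootRing h m) ⊗[R] L) :
    φ.twist m (((r ^ p ^ e) ⊗ₜ[A] toRoot h m a : R ⊗[A] RootRing h m) • y) =
      (r ⊗ₜ toRoot h (m + e) a) * φ.twist m y :=
  φ.extend_smul _ _ r (toRoot h m a) y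

/-- `φ.pow` is built only as an `R`-linear map; linearity over the roots of `A` is recovered here on
the level of images, because each twist passes a root of `a` through. -/
theorem RelCartierMap.root_mul_mem_range_pow (hR : (p : R) = 0) (φ : RelCartierMap h e R L)
    (n : ℕ) (a : A) (y : rootPower L (frob hR e) n) :
    (1 ⊗ₜ toRoot h (e * n) a) * φ.pow hR n y ∈ LinearMap.range (φ.pow hR n) := by
  induction n with
  | zero =>
    change R at y
    refine ⟨algebraMap A R a * y, ?_⟩
    change (algebraMap A R a * y) ⊗ₜ[A] (1 : RootRing h (e * 0)) =
      (1 ⊗ₜ toRoot h (e * 0) a) * (y ⊗ₜ[A] (1 : RootRing h (e * 0)))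
    rw [Algebra.TensorProduct.tmul_mul_tmul, ← Algebra.smul_def, TensorProduct.smul_tmul, one_mul,
      Algebra.smul_def, algebraMap_root]
    simp
  | succ n ih =>
    change L ⊗[R] rootPower L (frob hR e) n at y
    induction y using TensorProduct.induction_on with
    | zero => exact ⟨0, ((congrArg _ (map_zero (φ.pow hR (n + 1)))).trans (mul_zero _)).symm ▸
        map_zero (φ.pow hR (n + 1))⟩
    | add x y hx hy =>
      exact ((congrArg _ (map_add (φ.pow hR (n + 1)) x y)).trans (mul_add _ _ _)).symm ▸
        add_mem hx hy
    | tmul l y =>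
      obtain ⟨z, hz⟩ := ih y
      refine ⟨(l ⊗ₜ[R] z : L ⊗[R] rootPower L (frob hR e) n), ?_⟩
      rw [pow_succ_tmul, pow_succ_tmul, hz]
      have := φ.twist_smul (e * n) 1 a (φ.pow hR n y ⊗ₜ[R] l)
      rw [one_pow, TensorProduct.smul_tmul', smul_eq_mul] at this
      exact this

/-- The image of `φ^n` is an ideal. -/
theorem RelCartierMap.mem_sigma (hR : (p : R) = 0) (φ : RelCartierMap h e R L) (n : ℕ)
    (x : R ⊗[A] RootRing h (e * n)) : x ∈ φ.sigma hR n ↔ ∃ y, φ.pow hR n y = x := by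
  refine ⟨fun hx => ?_, fun ⟨y, hy⟩ => Ideal.subset_span ⟨y, hy⟩⟩
  induction hx using Submodule.span_induction with
  | mem x hx => exact hx
  | zero => exact ⟨0, map_zero _⟩
  | add x y _ _ hx hy =>
    obtain ⟨x, rfl⟩ := hx
    obtain ⟨y, rfl⟩ := hy
    exact ⟨x + y, map_add _ _ _⟩
  | smul c x _ hx =>
    obtain ⟨y, rfl⟩ := hx
    change c • φ.pow hR n y ∈ LinearMap.range (φ.pow hR n)
    induction c using TensorProduct.induction_on with
    | zero => rw [zero_smul]; exact zero_mem _
    | add c d hc hd => rw [add_smul]; exact add_mem hc hd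
    | tmul r a =>
      obtain ⟨a, rfl⟩ := (toRoot h (e * n)).surjective a
      have h1 : (r ⊗ₜ toRoot h (e * n) a : R ⊗[A] RootRing h (e * n)) • φ.pow hR n y =
          r • ((1 ⊗ₜ toRoot h (e * n) a) * φ.pow hR n y) := by
        rw [smul_eq_mul, ← smul_mul_assoc, TensorProduct.smul_tmul', smul_eq_mul, mul_one]
      rw [h1]
      exact Submodule.smul_mem _ _ (φ.root_mul_mem_range_pow hR n a y)

theorem RelCartierMap.sigma_zero (hR : (p : R) = 0) (φ : RelCartierMap h e R L) :
    φ.sigma hR 0 = ⊤ :=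
  (Ideal.eq_top_iff_one _).2 (Ideal.subset_span ⟨(1 : R), rfl⟩)

/-- Together with `RelCartierMap.sigma_succ_le`, this presents `σ_{n+1}` as generated by twists of
`σ_n`, which is what inductions on `n` use instead of tensor powers. -/
theorem RelCartierMap.twist_mem_sigma (hR : (p : R) = 0) (φ : RelCartierMap h e R L) {n : ℕ}
    {x : R ⊗[A] RootRing h (e * n)} (hx : x ∈ φ.sigma hR n) (l : L) :
    (φ.twist (e * n) (x ⊗ₜ[R] l) : R ⊗[A] RootRing h (e * (n + 1))) ∈ φ.sigma hR (n + 1) := by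
  obtain ⟨y, rfl⟩ := (φ.mem_sigma hR n x).1 hx
  exact (φ.mem_sigma hR (n + 1) _).2
    ⟨(l ⊗ₜ[R] y : L ⊗[R] rootPower L (frob hR e) n), φ.pow_succ_tmul hR n l y⟩

theorem RelCartierMap.sigma_succ_le (hR : (p : R) = 0) (φ : RelCartierMap h e R L) {n : ℕ}
    {J : Ideal (R ⊗[A] RootRing h (e * (n + 1)))}
    (hJ : ∀ x ∈ φ.sigma hR n, ∀ l, φ.twist (e * n) (x ⊗ₜ[R] l) ∈ J) : φ.sigma hR (n + 1) ≤ J := by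
  refine Ideal.span_le.2 ?_
  rintro _ ⟨y, rfl⟩
  change L ⊗[R] rootPower L (frob hR e) n at y
  induction y using TensorProduct.induction_on with
  | zero => exact (map_zero (φ.pow hR (n + 1))).symm ▸ zero_mem _
  | add x y hx hy => exact (map_add (φ.pow hR (n + 1)) x y).symm ▸ add_mem hx hy
  | tmul l y => exact hJ _ (Ideal.subset_span ⟨y, rfl⟩) l

section BaseChange

attribute [local instance] Algebra.TensorProduct.rightAlgebra

variable {B : Type u} [CommRing B] [Algebra A B]

theorem baseChangeMap_tmul (hB : (p : B) = 0) (m : ℕ) (r : R) (a : A) :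
    baseChangeMap R h hB m (r ⊗ₜ toRoot h m a) =
      (r ⊗ₜ 1) ⊗ₜ toRoot hB m (algebraMap A B a) := by
  simp [baseChangeMap, rootMap]

theorem RelCartierMap.baseChange_tmul (φ : RelCartierMap h e R L) (hB : (p : B) = 0) (r : R)
    (b : B) (l : L) :
    (φ.baseChange hB).toFun ((r ⊗ₜ[A] b) ⊗ₜ[R] l) =
      baseChangeMap R h hB e (φ.toFun (r • l)) * (1 ⊗ₜ toRoot hB e b) := by
  have hj : ∀ a, algebraMap A (RootRing hB e) a
      = (toRoot hB e).toRingHom (algebraMap A B a) ^ p ^ e := fun a => by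
    simp [algebraMap_root]
  let ν : R ⊗[A] RootRing hB e →+* (R ⊗[A] B) ⊗[B] RootRing hB e :=
    Algebra.TensorProduct.mapRingHom (algebraMap A B) Algebra.TensorProduct.includeLeftRingHom
      (RingHom.id _) (RingHom.ext fun a => Algebra.TensorProduct.tmul_one_eq_one_tmul a)
      (by ext a; simp [algebraMap_root])
  change ν (φ.extend (toRoot hB e).toRingHom hj ((r ⊗ₜ[A] b) ⊗ₜ[R] l)) = _
  rw [φ.extend_tmul, map_mul]
  congr 1
  · induction φ.toFun (r • l) using TensorProduct.induction_on with
    | zero => simp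
    | add x y hx hy => rw [map_add, map_add, map_add, hx, hy]
    | tmul r a =>
      obtain ⟨a, rfl⟩ := (toRoot h e).surjective a
      rw [baseChangeMap_tmul]
      simp [rootLift_toRoot, ν]
  · simp [ν, Algebra.TensorProduct.one_def]

theorem RelCartierMap.twist_tmul (φ : RelCartierMap h e R L) (m : ℕ) (r : R) (a : A) (l : L) :
    φ.twist m ((r ⊗ₜ[A] toRoot h m a) ⊗ₜ[R] l) =
      Algebra.TensorProduct.map (AlgHom.id A R) (rootLift h e
        ((toRoot h (m + e)).toRingHom.comp (toRoot h m).symm.toRingHom) (fun a => by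
          simp [algebraMap_root, pow_add, pow_mul])) (φ.toFun (r • l)) *
        (1 ⊗ₜ toRoot h (m + e) a) :=
  φ.extend_tmul _ _ r (toRoot h m a) l

theorem RelCartierMap.twist_baseChange (φ : RelCartierMap h e R L) (hB : (p : B) = 0) (m : ℕ)
    (x : R ⊗[A] RootRing h m) (l : L) :
    (φ.baseChange hB).twist m
      (baseChangeMap R h hB m x ⊗ₜ[R ⊗[A] B] ((1 : R ⊗[A] B) ⊗ₜ[R] l)) =
    baseChangeMap R h hB (m + e) (φ.twist m (x ⊗ₜ[R] l)) := by
  induction x using TensorProduct.induction_on with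
  | zero => simp
  | add x y hx hy => rw [map_add, TensorProduct.add_tmul, map_add, hx, hy, TensorProduct.add_tmul,
      map_add, map_add]
  | tmul r a =>
    obtain ⟨a, rfl⟩ := (toRoot h m).surjective a
    rw [baseChangeMap_tmul, twist_tmul, twist_tmul, map_mul, TensorProduct.smul_tmul', smul_eq_mul,
      mul_one, baseChange_tmul, map_one, ← Algebra.TensorProduct.one_def, mul_one,
      baseChangeMap_tmul, ← Algebra.TensorProduct.one_def]
    congr 1
    induction φ.toFun (r • l) using TensorProduct.induction_on with
    | zero => simp
    | add x y hx hy => simp only [map_add, hx, hy]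
    | tmul r a =>
      obtain ⟨a, rfl⟩ := (toRoot h e).surjective a
      rw [baseChangeMap_tmul, Algebra.TensorProduct.map_tmul, Algebra.TensorProduct.map_tmul,
        rootLift_toRoot, rootLift_toRoot]
      simp only [algebraMap_root, RingHom.comp_apply, Algebra.algebraMap_self_apply, AlgHom.id_apply,
        RingEquiv.toRingHom_eq_coe, RingHom.coe_coe, RingEquiv.symm_apply_apply]
      rw [baseChangeMap_tmul]
      simp only [map_pow]

theorem RelCartierMap.sigmaExtended_eq (hR : (p : R) = 0) (φ : RelCartierMap h e R L)
    (hB : (p : B) = 0) (n : ℕ) : φ.sigmaExtended hR hB n = φ.sigmaBaseChange hB n := by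
  have hS : (p : R ⊗[A] B) = 0 := natCast_eq_zero_of_ringHom (algebraMap B (R ⊗[A] B)) hB
  rw [sigmaExtended, sigmaBaseChange]
  induction n with
  | zero => rw [sigma_zero, sigma_zero, Ideal.map_top]
  | succ n ih =>
    apply le_antisymm
    · rw [Ideal.map_le_iff_le_comap]
      refine φ.sigma_succ_le hR fun x hx l => ?_
      rw [Ideal.mem_comap]
      have h1 := (φ.baseChange hB).twist_mem_sigma hS
        (ih ▸ Ideal.mem_map_of_mem (baseChangeMap R h hB (e * n)) hx) ((1 : R ⊗[A] B) ⊗ₜ[R] l)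
      rw [twist_baseChange] at h1
      exact h1
    · refine (φ.baseChange hB).sigma_succ_le hS fun x hx l => ?_
      rw [← ih] at hx
      induction l using TensorProduct.induction_on with
      | zero => simp
      | add l l' hl hl' => rw [TensorProduct.tmul_add, map_add]; exact add_mem hl hl'
      | tmul c l =>
        have h1 : x ⊗ₜ[R ⊗[A] B] (c ⊗ₜ[R] l) = (c • x) ⊗ₜ[R ⊗[A] B] ((1 : R ⊗[A] B) ⊗ₜ[R] l) := by
          rw [TensorProduct.smul_tmul, TensorProduct.smul_tmul', smul_eq_mul, mul_one]
        rw [h1]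
        have h2 : c • x ∈ (φ.sigma hR n).map (baseChangeMap R h hB (e * n)) := by
          rw [Algebra.smul_def]
          exact Ideal.mul_mem_left _ _ hx
        -- The twist is not linear over the whole ring, so membership of the twist is not stable
        -- under scalars in its argument; quantifying over a multiplier `d` makes span induction
        -- possible.
        suffices key : ∀ d : (R ⊗[A] B) ⊗[B] RootRing hB (e * n),
            ((φ.baseChange hB).twist (e * n) ((d * (c • x)) ⊗ₜ[R ⊗[A] B] ((1 : R ⊗[A] B) ⊗ₜ[R] l)) :
              (R ⊗[A] B) ⊗[B] RootRing hB (e * (n + 1))) ∈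
            (φ.sigma hR (n + 1)).map (baseChangeMap R h hB (e * (n + 1))) by
          simpa using key 1
        generalize c • x = x at h2
        clear h1 hx
        induction h2 using Submodule.span_induction with
        | zero => simp
        | add x y _ _ hx hy =>
          intro d
          rw [mul_add d x y, TensorProduct.add_tmul, map_add]
          exact add_mem (hx d) (hy d)
        | smul c x _ hx => exact fun d => by simpa [mul_assoc] using hx (d * c)
        | mem x hx =>
          obtain ⟨x, hx, rfl⟩ := hx
          intro d
          induction d using TensorProduct.induction_on with
          | zero => simp
          | add c d hc hd =>
            rw [add_mul, TensorProduct.add_tmul, map_add]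
            exact add_mem hc hd
          | tmul c b =>
            induction c using TensorProduct.induction_on with
            | zero => simp
            | add c d hc hd =>
              rw [TensorProduct.add_tmul, add_mul, TensorProduct.add_tmul, map_add]
              exact add_mem hc hd
            | tmul r c =>
              -- The factor `r` is absorbed into `σ_n`, while `c` and `b` merge into one root of an
              -- element `b'` of `B`, over which the twist is linear.
              obtain ⟨b', hb'⟩ := (toRoot hB (e * n)).surjective (c • b)
              have h3 : ((r ⊗ₜ[A] c) ⊗ₜ[B] b) * baseChangeMap R h hB (e * n) x =
                  (((1 : R ⊗[A] B) ^ p ^ e) ⊗ₜ[B] toRoot hB (e * n) b') *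
                    baseChangeMap R h hB (e * n) ((r ⊗ₜ 1) * x) := by
                have h4 : (r ⊗ₜ[A] c : R ⊗[A] B) = c • (r ⊗ₜ[A] 1) := by
                  rw [Algebra.smul_def]
                  change _ = (1 ⊗ₜ[A] c) * (r ⊗ₜ[A] 1)
                  simp
                have h5 := baseChangeMap_tmul (h := h) hB (e * n) r 1
                rw [map_one, map_one, map_one] at h5
                rw [h4, TensorProduct.smul_tmul, ← hb', map_mul, h5, ← mul_assoc,
                  Algebra.TensorProduct.tmul_mul_tmul, one_pow, one_mul, mul_one]
              have h6 := (φ.baseChange hB).twist_smul (e * n) 1 b'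
                (baseChangeMap R h hB (e * n) ((r ⊗ₜ 1) * x) ⊗ₜ[R ⊗[A] B]
                  ((1 : R ⊗[A] B) ⊗ₜ[R] l))
              rw [TensorProduct.smul_tmul', smul_eq_mul, twist_baseChange] at h6
              rw [h3, h6]
              exact Ideal.mul_mem_left _ _ (Ideal.mem_map_of_mem _
                (φ.twist_mem_sigma hR (Ideal.mul_mem_left _ _ hx) l))

end BaseChange

end Relative

end

end RelFPure

namespace RelFPure

noncomputable section

/-! ## The relative ideals on perfect fibers -/

theorem map_iterateFrobeniusEquiv_symm {p : ℕ} {D D' : Type u} [CommRing D] [ExpChar D p] [PerfectRing D p]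
    [CommRing D'] [ExpChar D' p] [PerfectRing D' p] (g : D →+* D') (m : ℕ) (d : D) :
    g ((iterateFrobeniusEquiv D p m).symm d) = (iterateFrobeniusEquiv D' p m).symm (g d) := by
  apply (iterateFrobeniusEquiv D' p m).injective
  rw [RingEquiv.apply_symm_apply, iterateFrobeniusEquiv_def, ← map_pow,
    ← iterateFrobeniusEquiv_def, RingEquiv.apply_symm_apply]

section Perfect

variable {p : ℕ} [Fact p.Prime] {e : ℕ} {K : Type u} [Field K] [CharP K p] [PerfectField K]
  {hK : (p : K) = 0} {S M : Type u} [CommRing S] [Algebra K S] [AddCommGroup M] [Module S M]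

theorem perfectIdent_tmul (m : ℕ) (s : S) (a : K) :
    perfectIdent hK S m (s ⊗ₜ toRoot hK m a) =
      s * algebraMap K S ((iterateFrobeniusEquiv K p m).symm a) := rfl

/-- In `K` a `p^{m+e}`-th root is a `p^e`-th root of a `p^m`-th root, so scalars of `K` can be moved
through `φ`. This is the inductive step comparing `φ^n` with `ψ^n`. -/
theorem RelCartierMap.perfectIdent_twist (φ : RelCartierMap hK e S M) (m : ℕ)
    (x : S ⊗[K] RootRing hK m) (l : M) :
    perfectIdent hK S (m + e) (φ.twist m (x ⊗ₜ[S] l)) =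
      φ.toCartierMap.toFun (perfectIdent hK S m x • l) := by
  induction x using TensorProduct.induction_on with
  | zero => simp
  | add x y hx hy => rw [TensorProduct.add_tmul, map_add, map_add, hx, hy, map_add, add_smul,
      map_add]
  | tmul s a =>
    obtain ⟨a, rfl⟩ := (toRoot hK m).surjective a
    rw [twist_tmul, map_mul, perfectIdent_tmul, perfectIdent_tmul, one_mul, mul_comm s, mul_smul]
    change _ = perfectIdent hK S e (φ.toFun _)
    rw [φ.map_base_smul, map_mul, perfectIdent_tmul, one_mul, mul_comm]
    congr 1
    · rw [add_comm m e, iterateFrobeniusEquiv_symm_add_apply]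
    · induction φ.toFun (s • l) using TensorProduct.induction_on with
      | zero => simp
      | add x y hx hy => rw [map_add, map_add, map_add, hx, hy]
      | tmul s a =>
        obtain ⟨a, rfl⟩ := (toRoot hK e).surjective a
        rw [Algebra.TensorProduct.map_tmul, rootLift_toRoot, perfectIdent_tmul]
        simp only [algebraMap_root, RingHom.comp_apply, Algebra.algebraMap_self_apply,
          AlgHom.id_apply, RingEquiv.toRingHom_eq_coe, RingHom.coe_coe, RingEquiv.symm_apply_apply]
        rw [perfectIdent_tmul, add_comm m e, iterateFrobeniusEquiv_symm_add_apply,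
          ← iterateFrobeniusEquiv_def K p m a, RingEquiv.symm_apply_apply]

theorem RelCartierMap.perfectIdent_pow (hS : (p : S) = 0) (φ : RelCartierMap hK e S M) (n : ℕ)
    (y : rootPower M (frob hS e) n) :
    perfectIdent hK S (e * n) (φ.pow hS n y) = φ.toCartierMap.pow hS n y := by
  induction n with
  | zero =>
    change S at y
    change perfectIdent hK S (e * 0) (y ⊗ₜ (1 : RootRing hK (e * 0))) = y
    rw [← map_one (toRoot hK (e * 0)), perfectIdent_tmul, map_one, map_one, mul_one]
  | succ n ih =>
    change M ⊗[S] rootPower M (frob hS e) n at y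
    induction y using TensorProduct.induction_on with
    | zero =>
      exact (congrArg _ (map_zero (φ.pow hS (n + 1)))).trans ((map_zero _).trans
        (map_zero (φ.toCartierMap.pow hS (n + 1))).symm)
    | add x y hx hy =>
      refine (congrArg _ (map_add (φ.pow hS (n + 1)) x y)).trans ((map_add _ _ _).trans ?_)
      exact (congrArg₂ (· + ·) hx hy).trans (map_add (φ.toCartierMap.pow hS (n + 1)) x y).symm
    | tmul m y =>
      rw [pow_succ_tmul, CartierMap.pow_succ_tmul, ← ih]
      exact φ.perfectIdent_twist (e * n) _ m

end Perfect

section Fiber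

attribute [local instance] Algebra.TensorProduct.rightAlgebra

variable {p : ℕ} [Fact p.Prime] {A : Type u} [CommRing A] {h : (p : A) = 0} {e : ℕ}
  {R L : Type u} [CommRing R] [Algebra A R] [AddCommGroup L] [Module R L]

theorem RelCartierMap.sigmaOnFiber_eq_iter (hR : (p : R) = 0) (φ : RelCartierMap h e R L)
    (K : Type u) [Field K] [CharP K p] [PerfectField K] [Algebra A K] (n : ℕ) :
    φ.sigmaOnFiber K hR n = (φ.fiberMap K).iter n := by
  have hK : (p : K) = 0 := CharP.cast_eq_zero K p
  have hS : (p : R ⊗[A] K) = 0 := natCast_eq_zero_of_ringHom (algebraMap K (R ⊗[A] K)) hK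
  rw [sigmaOnFiber, sigmaExtended_eq, sigmaBaseChange, ← CartierMap.range_pow hS]
  apply le_antisymm
  · refine Ideal.map_le_iff_le_comap.2 fun x hx => ?_
    obtain ⟨y, rfl⟩ := ((φ.baseChange hK).mem_sigma hS n x).1 hx
    exact ⟨y, ((φ.baseChange hK).perfectIdent_pow hS n y).symm⟩
  · rintro _ ⟨y, rfl⟩
    have h1 := (φ.baseChange hK).perfectIdent_pow hS n y
    rw [RelCartierMap.fiberMap, ← h1]
    exact Ideal.mem_map_of_mem _ (((φ.baseChange hK).mem_sigma hS n _).2 ⟨y, rfl⟩)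

variable (D : Type u) [CommRing D] [ExpChar D p] [PerfectRing D p] [Algebra A D]

/-- The map `A^{1/p^m} → D` induced by `A → D`, for a perfect ring `D`. -/
def rootToPerfect (h : (p : A) = 0) (m : ℕ) : RootRing h m →ₐ[A] D :=
  { ((iterateFrobeniusEquiv D p m).symm.toRingHom.comp (algebraMap A D)).comp
      (toRoot h m).symm.toRingHom with
    commutes' := fun a => by
      exact (congrArg _ (map_pow (algebraMap A D) a _)).trans
        ((iterateFrobeniusEquiv D p m).symm_apply_apply _) }

/-- The map `R_{A^{1/p^m}} → R_D` induced by `A → D`, for a perfect ring `D`. -/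
def rootEval (R : Type u) [CommRing R] [Algebra A R] (h : (p : A) = 0) (m : ℕ) :
    R ⊗[A] RootRing h m →ₐ[R] R ⊗[A] D :=
  Algebra.TensorProduct.map (AlgHom.id R R) (rootToPerfect D h m)

theorem rootEval_tmul (m : ℕ) (r : R) (a : A) :
    rootEval D R h m (r ⊗ₜ toRoot h m a) =
      r ⊗ₜ (iterateFrobeniusEquiv D p m).symm (algebraMap A D a) := rfl

theorem map_rootEval {D' : Type u} [CommRing D'] [ExpChar D' p] [PerfectRing D' p]
    [Algebra A D'] (g : D →ₐ[A] D') (m : ℕ) (x : R ⊗[A] RootRing h m) :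
    Algebra.TensorProduct.map (AlgHom.id R R) g (rootEval D R h m x) = rootEval D' R h m x := by
  induction x using TensorProduct.induction_on with
  | zero => simp
  | add x y hx hy => simp only [map_add, hx, hy]
  | tmul r a =>
    obtain ⟨a, rfl⟩ := (toRoot h m).surjective a
    rw [rootEval_tmul, rootEval_tmul, Algebra.TensorProduct.map_tmul]
    congr 1
    exact (map_iterateFrobeniusEquiv_symm g.toRingHom m _).trans
      (congrArg _ (g.commutes a))

variable (K : Type u) [Field K] [CharP K p] [PerfectField K] [Algebra A K]

theorem perfectIdent_baseChangeMap (m : ℕ) (x : R ⊗[A] RootRing h m) :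
    perfectIdent (CharP.cast_eq_zero K p) (R ⊗[A] K) m
      (baseChangeMap R h (CharP.cast_eq_zero K p) m x) = rootEval K R h m x := by
  induction x using TensorProduct.induction_on with
  | zero => simp
  | add x y hx hy => simp only [map_add, hx, hy]
  | tmul r a =>
    obtain ⟨a, rfl⟩ := (toRoot h m).surjective a
    rw [rootEval_tmul, baseChangeMap_tmul, perfectIdent_tmul]
    change (r ⊗ₜ 1) * (1 ⊗ₜ _) = _
    simp

/-- The two-step extension collapses to one along `rootEval`, which makes sense for any perfect ring
and so lets ideals on fibers be compared through a perfect domain `D`. -/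
theorem RelCartierMap.sigmaOnFiber_eq_map (hR : (p : R) = 0) (φ : RelCartierMap h e R L) (n : ℕ) :
    φ.sigmaOnFiber K hR n = (φ.sigma hR n).map (rootEval K R h (e * n)) := by
  rw [sigmaOnFiber, sigmaExtended]
  apply le_antisymm
  · refine Ideal.map_le_iff_le_comap.2 (Ideal.map_le_iff_le_comap.2 fun x hx => ?_)
    rw [Ideal.mem_comap, Ideal.mem_comap, perfectIdent_baseChangeMap]
    exact Ideal.mem_map_of_mem _ hx
  · refine Ideal.map_le_iff_le_comap.2 fun x hx => ?_
    rw [Ideal.mem_comap, ← perfectIdent_baseChangeMap]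
    exact Ideal.mem_map_of_mem _ (Ideal.mem_map_of_mem _ hx)

theorem RelCartierMap.fiberMap_tmul (φ : RelCartierMap h e R L) (r : R) (k : K) (l : L) :
    (φ.fiberMap K).toFun ((r ⊗ₜ[A] k) ⊗ₜ[R] l) =
      rootEval K R h e (φ.toFun (r • l)) * (1 ⊗ₜ (iterateFrobeniusEquiv K p e).symm k) := by
  change perfectIdent _ _ e ((φ.baseChange _).toFun ((r ⊗ₜ[A] k) ⊗ₜ[R] l)) = _
  rw [baseChange_tmul, map_mul, perfectIdent_baseChangeMap, perfectIdent_tmul, one_mul]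
  rfl

end Fiber

end

end RelFPure

namespace RelFPure

noncomputable section

/-! ## Uniform stabilization over an affine base -/

section Uniform

theorem isNoetherianRing_tensorProduct (A R B : Type u) [CommRing A] [CommRing R] [CommRing B]
    [Algebra A R] [Algebra A B] [Algebra.FiniteType A R] [IsNoetherianRing B] :
    IsNoetherianRing (R ⊗[A] B) := by
  have := Algebra.FiniteType.isNoetherianRing B (B ⊗[A] R)
  exact isNoetherianRing_of_ringEquiv _ (Algebra.TensorProduct.comm A B R).toRingEquiv

/-- Some `p`-power of every element comes from `k`, so a vanishing product can be tested in `k`. -/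
theorem isDomain_perfectClosure (k : Type u) [CommRing k] [IsDomain k] (p : ℕ) [Fact p.Prime]
    [CharP k p] : IsDomain (PerfectClosure k p) := by
  have hinj : Function.Injective (PerfectClosure.of k p) := fun x y hxy => by
    simpa [PerfectClosure.of_apply, PerfectClosure.eq_iff] using hxy
  have : Nontrivial (PerfectClosure k p) := hinj.nontrivial
  have : NoZeroDivisors (PerfectClosure k p) := ⟨fun {x y} hxy => by
    obtain ⟨m, a, ha⟩ := IsPRadical.pow_mem (PerfectClosure.of k p) p x
    obtain ⟨n, b, hb⟩ := IsPRadical.pow_mem (PerfectClosure.of k p) p y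
    have h1 : PerfectClosure.of k p (a ^ p ^ n * b ^ p ^ m) = 0 := by
      rw [map_mul, map_pow, map_pow, ha, hb, ← pow_mul, ← pow_mul, mul_comm (p ^ n), ← mul_pow, hxy,
        zero_pow (mul_ne_zero (pow_ne_zero _ (Fact.out : p.Prime).ne_zero)
          (pow_ne_zero _ (Fact.out : p.Prime).ne_zero))]
    rcases mul_eq_zero.1 ((map_eq_zero_iff _ hinj).1 h1) with h2 | h2
    · left
      rw [eq_zero_of_pow_eq_zero h2, map_zero] at ha
      exact eq_zero_of_pow_eq_zero ha.symm
    · right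
      rw [eq_zero_of_pow_eq_zero h2, map_zero] at hb
      exact eq_zero_of_pow_eq_zero hb.symm⟩
  exact NoZeroDivisors.to_isDomain _

theorem perfectRing_fractionRing (D : Type u) [CommRing D] [IsDomain D] (p : ℕ) [Fact p.Prime]
    [CharP D p] [PerfectRing D p] [CharP (FractionRing D) p] : PerfectRing (FractionRing D) p := by
  refine PerfectRing.ofSurjective _ p fun x => ?_
  obtain ⟨a, b, hb, rfl⟩ := IsFractionRing.div_surjective (A := D) x
  obtain ⟨a, rfl⟩ := surjective_frobenius D p a
  obtain ⟨b, rfl⟩ := surjective_frobenius D p b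
  exact ⟨algebraMap D _ a / algebraMap D _ b, by simp [frobenius_def]⟩

/-- If `u` lies in the extension of the ideal `J` along `R ⊗ D → R ⊗ Frac D`, then a nonzero
multiple of `u` lies in `J`. -/
theorem exists_mul_mem_of_mem_map_fractionRing {A R D : Type u} [CommRing A] [CommRing R]
    [CommRing D] [IsDomain D] [Algebra A R] [Algebra A D] (J : Ideal (R ⊗[A] D)) (u : R ⊗[A] D)
    (hu : Algebra.TensorProduct.map (AlgHom.id R R)
        (IsScalarTower.toAlgHom A D (FractionRing D)) u ∈
      J.map (Algebra.TensorProduct.map (AlgHom.id R R)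
        (IsScalarTower.toAlgHom A D (FractionRing D)))) :
    ∃ d : D, d ≠ 0 ∧ ((1 : R) ⊗ₜ[A] d) * u ∈ J := by
  let i : D →ₐ[A] R ⊗[A] D := Algebra.TensorProduct.includeRight
  let M : Submonoid (R ⊗[A] D) := (nonZeroDivisors D).map i
  let T := Localization M
  let j : FractionRing D →ₐ[A] T := IsLocalization.liftAlgHom (M := nonZeroDivisors D)
    (f := (IsScalarTower.toAlgHom A (R ⊗[A] D) T).comp i) fun d =>
      IsLocalization.map_units T (⟨i d, d, d.2, rfl⟩ : M)
  let f := Algebra.TensorProduct.map (AlgHom.id R R) (IsScalarTower.toAlgHom A D (FractionRing D))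
  -- A map to the localization `T` compatible with the map from `R ⊗ D` is enough; that it is an
  -- isomorphism is not needed.
  let g : R ⊗[A] FractionRing D →ₐ[A] T := Algebra.TensorProduct.lift
    ((IsScalarTower.toAlgHom A (R ⊗[A] D) T).comp Algebra.TensorProduct.includeLeft) j
    fun _ _ => .all _ _
  have hgf (x : R ⊗[A] D) : g (f x) = algebraMap (R ⊗[A] D) T x := by
    induction x using TensorProduct.induction_on with
    | zero => simp
    | add x y hx hy => simp only [map_add, hx, hy]
    | tmul r d =>
      have h1 : j (algebraMap D (FractionRing D) d) = algebraMap (R ⊗[A] D) T (1 ⊗ₜ d) := by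
        exact IsLocalization.lift_eq _ d
      simp only [f, g, Algebra.TensorProduct.map_tmul, Algebra.TensorProduct.lift_tmul]
      change algebraMap (R ⊗[A] D) T (r ⊗ₜ 1) * j (algebraMap D (FractionRing D) d) = _
      rw [h1, ← map_mul]
      simp
  have h2 : algebraMap (R ⊗[A] D) T u ∈ J.map (algebraMap (R ⊗[A] D) T) := by
    have h3 := Ideal.mem_map_of_mem g hu
    rw [← hgf]
    refine (?_ : (J.map f).map g ≤ J.map (algebraMap (R ⊗[A] D) T)) h3
    rw [Ideal.map_le_iff_le_comap, Ideal.map_le_iff_le_comap]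
    intro x hx
    rw [Ideal.mem_comap, Ideal.mem_comap, hgf]
    exact Ideal.mem_map_of_mem _ hx
  obtain ⟨_, ⟨d, hd, rfl⟩, h3⟩ := (IsLocalization.algebraMap_mem_map_algebraMap_iff M T J u).1 h2
  exact ⟨d, nonZeroDivisors.ne_zero hd, h3⟩

variable {p : ℕ} [Fact p.Prime] {A : Type u} [CommRing A] {h : (p : A) = 0} {e : ℕ}
  {R L : Type u} [CommRing R] [Algebra A R] [AddCommGroup L] [Module R L]

/-- If the `N`-th and `(N+1)`-st ideals agree over the fraction field of the perfect domain `D`,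
then they agree after multiplication with a nonzero element of `D`. -/
theorem RelCartierMap.exists_mul_rootEval_mem [IsNoetherianRing A] [Algebra.FiniteType A R]
    (hR : (p : R) = 0) (φ : RelCartierMap h e R L) (D : Type u) [CommRing D] [IsDomain D]
    [Algebra A D] [CharP D p] [PerfectRing D p] [CharP (FractionRing D) p]
    [PerfectRing (FractionRing D) p] (N : ℕ)
    (hN : (φ.sigma hR N).map (rootEval (FractionRing D) R h (e * N)) ≤
      (φ.sigma hR (N + 1)).map (rootEval (FractionRing D) R h (e * (N + 1)))) :
    ∃ d : D, d ≠ 0 ∧ ∀ x ∈ φ.sigma hR N, (1 ⊗ₜ d) * rootEval D R h (e * N) x ∈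
      (φ.sigma hR (N + 1)).map (rootEval D R h (e * (N + 1))) := by
  -- Finite generation is taken over a root of `A`, which as a ring is `A`, because finite
  -- generation over `R ⊗ D` is not available from Noetherianity of `D`.
  have : IsNoetherianRing (RootRing h (e * N)) := inferInstanceAs (IsNoetherianRing A)
  have := isNoetherianRing_tensorProduct A R (RootRing h (e * N))
  obtain ⟨G, hG⟩ := IsNoetherian.noetherian (φ.sigma hR N)
  set J := (φ.sigma hR (N + 1)).map (rootEval D R h (e * (N + 1))) with hJ
  let g : D →ₐ[A] FractionRing D := IsScalarTower.toAlgHom A D (FractionRing D)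
  have h1 (x) (hx : x ∈ φ.sigma hR N) : ∃ d : D, d ≠ 0 ∧ (1 ⊗ₜ d) * rootEval D R h (e * N) x ∈ J := by
    apply exists_mul_mem_of_mem_map_fractionRing
    rw [map_rootEval]
    refine (hN.trans ?_) (Ideal.mem_map_of_mem _ hx)
    refine Ideal.map_le_iff_le_comap.2 fun y hy => ?_
    rw [Ideal.mem_comap, ← map_rootEval D g]
    exact Ideal.mem_map_of_mem _ (Ideal.mem_map_of_mem _ hy)
  choose! d hd hd' using h1
  refine ⟨∏ x ∈ G, d x, Finset.prod_ne_zero_iff.2 fun x hx =>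
    hd x (hG ▸ Submodule.subset_span hx), fun x hx => ?_⟩
  have h2 : φ.sigma hR N ≤ Ideal.comap (rootEval D R h (e * N)) (Submodule.comap (LinearMap.mulLeft (R ⊗[A] D)
      (1 ⊗ₜ ∏ x ∈ G, d x)) J) := by
    conv_lhs => rw [← hG]
    refine Submodule.span_le.2 fun x hx => ?_
    obtain ⟨c, hc⟩ := Finset.dvd_prod_of_mem d hx
    change (1 ⊗ₜ ∏ x ∈ G, d x) * rootEval D R h (e * N) x ∈ J
    have h3 : (1 : R) ⊗ₜ[A] (d x * c) = (1 ⊗ₜ c) * (1 ⊗ₜ d x) := by simp [mul_comm]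
    rw [hc, h3, mul_assoc]
    exact Ideal.mul_mem_left _ _ (hd' x (hG ▸ Submodule.subset_span hx))
  exact h2 hx

/-- Stabilization at the perfected generic point of `V(P)` spreads out to a nonempty open part of
`V(P)`. The perfect closure is used because it maps to every perfect field over `A/P`. -/
theorem RelCartierMap.exists_stable_of_prime [IsNoetherianRing A] [Algebra.FiniteType A R]
    (he : 0 < e) (hR : (p : R) = 0) (φ : RelCartierMap h e R L) (P : Ideal A) [P.IsPrime] :
    ∃ N, ∃ a ∉ P, ∀ (K : Type u) [Field K] [CharP K p] [PerfectField K] [Algebra A K],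
      (∀ x ∈ P, algebraMap A K x = 0) → algebraMap A K a ≠ 0 →
      (φ.fiberMap K).iter N ≤ (φ.fiberMap K).iter (N + 1) := by
  have hp : p.Prime := Fact.out
  have : CharP (A ⧸ P) p := (CharP.charP_iff_prime_eq_zero hp).2
    (natCast_eq_zero_of_ringHom (Ideal.Quotient.mk P) h)
  let D := PerfectClosure (A ⧸ P) p
  let i : A →+* D := (PerfectClosure.of (A ⧸ P) p).comp (Ideal.Quotient.mk P)
  let : Algebra A D := i.toAlgebra
  have : IsDomain D := isDomain_perfectClosure (A ⧸ P) p
  have : CharP (FractionRing D) p := charP_of_injective_algebraMap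
    (IsFractionRing.injective D (FractionRing D)) p
  have : PerfectRing (FractionRing D) p := perfectRing_fractionRing D p
  have : PerfectField (FractionRing D) := PerfectRing.toPerfectField _ p
  have := isNoetherianRing_tensorProduct A R (FractionRing D)
  obtain ⟨N, hN⟩ := (φ.fiberMap (FractionRing D)).exists_iter_le_succ he
  rw [← φ.sigmaOnFiber_eq_iter hR, ← φ.sigmaOnFiber_eq_iter hR, φ.sigmaOnFiber_eq_map _ hR,
    φ.sigmaOnFiber_eq_map _ hR] at hN
  obtain ⟨d, hd, hd'⟩ := φ.exists_mul_rootEval_mem hR D N hN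
  -- The denominator `d` lives in the perfect closure; a `p`-power of it descends to `A/P` and has
  -- the same vanishing locus.
  obtain ⟨m, a, ha⟩ := IsPRadical.pow_mem (PerfectClosure.of (A ⧸ P) p) p d
  obtain ⟨a, rfl⟩ := Ideal.Quotient.mk_surjective a
  refine ⟨N, a, fun haP => ?_, ?_⟩
  · rw [Ideal.Quotient.eq_zero_iff_mem.2 haP, map_zero] at ha
    exact hd (eq_zero_of_pow_eq_zero ha.symm)
  intro K _ _ _ _ hK ha0
  let j : A ⧸ P →+* K := Ideal.Quotient.lift P (algebraMap A K) hK
  let g : D →ₐ[A] K :=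
    { PerfectRing.lift (PerfectClosure.of (A ⧸ P) p) j p with
      commutes' := fun x => PerfectRing.lift_comp_apply (PerfectClosure.of (A ⧸ P) p) j p _ }
  have hg : g d ≠ 0 := fun hgd => ha0 <| by
    have h1 : g (d ^ p ^ m) = algebraMap A K a := by
      rw [← ha]
      exact g.commutes a
    rw [← h1, map_pow, hgd, zero_pow (pow_ne_zero _ hp.ne_zero)]
  rw [← φ.sigmaOnFiber_eq_iter hR, ← φ.sigmaOnFiber_eq_iter hR, φ.sigmaOnFiber_eq_map K hR,
    φ.sigmaOnFiber_eq_map K hR]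
  refine Ideal.map_le_iff_le_comap.2 fun x hx => ?_
  rw [Ideal.mem_comap]
  have h2 := Ideal.mem_map_of_mem (Algebra.TensorProduct.map (AlgHom.id R R) g) (hd' x hx)
  rw [map_mul, map_rootEval, Algebra.TensorProduct.map_tmul, map_one] at h2
  have h3 : ((φ.sigma hR (N + 1)).map (rootEval D R h (e * (N + 1)))).map
      (Algebra.TensorProduct.map (AlgHom.id R R) g) ≤
      (φ.sigma hR (N + 1)).map (rootEval K R h (e * (N + 1))) := by
    refine Ideal.map_le_iff_le_comap.2 (Ideal.map_le_iff_le_comap.2 fun y hy => ?_)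
    rw [Ideal.mem_comap, Ideal.mem_comap, map_rootEval]
    exact Ideal.mem_map_of_mem _ hy
  have h4 := Ideal.mul_mem_left _ ((1 : R) ⊗ₜ[A] (g d)⁻¹) (h3 h2)
  rwa [← mul_assoc, Algebra.TensorProduct.tmul_mul_tmul, one_mul, inv_mul_cancel₀ hg,
    ← Algebra.TensorProduct.one_def, one_mul] at h4

/-- The images of the iterates of `φ` stabilize uniformly on all perfect fibers. -/
theorem RelCartierMap.exists_forall_iter_le_succ [IsNoetherianRing A] [Algebra.FiniteType A R]
    (he : 0 < e) (hR : (p : R) = 0) (φ : RelCartierMap h e R L) :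
    ∃ N, ∀ n, N ≤ n → ∀ (K : Type u) [Field K] [CharP K p] [PerfectField K] [Algebra A K],
      (φ.fiberMap K).iter n ≤ (φ.fiberMap K).iter (n + 1) := by
  -- Noetherian induction needs the statement on each closed subset `V(I)`. It is asked for all `n ≥
  -- N` so that bounds from different strata can be combined by `max`.
  suffices key : ∀ I : Ideal A, ∃ N, ∀ n, N ≤ n →
      ∀ (K : Type u) [Field K] [CharP K p] [PerfectField K] [Algebra A K],
      (∀ x ∈ I, algebraMap A K x = 0) → (φ.fiberMap K).iter n ≤ (φ.fiberMap K).iter (n + 1) by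
    obtain ⟨N, hN⟩ := key ⊥
    exact ⟨N, fun n hn K _ _ _ _ => hN n hn K (by simp)⟩
  refine IsNoetherian.induction fun (I : Ideal A) ih => ?_
  have hlt {a : A} (ha : a ∉ I) : I < I ⊔ Ideal.span {a} := left_lt_sup.2 fun h1 =>
    ha (h1 (Ideal.mem_span_singleton_self a))
  have hker {K : Type u} [Field K] [Algebra A K] {a : A} (hI : ∀ x ∈ I, algebraMap A K x = 0)
      (ha : algebraMap A K a = 0) : ∀ x ∈ I ⊔ Ideal.span {a}, algebraMap A K x = 0 := by
    have : I ⊔ Ideal.span {a} ≤ RingHom.ker (algebraMap A K) :=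
      sup_le hI ((Ideal.span_singleton_le_iff_mem _).2 ha)
    exact this
  by_cases htop : I = ⊤
  · refine ⟨0, fun n _ K _ _ _ _ hI => ?_⟩
    exact absurd (hI 1 (htop ▸ trivial)) (by simp)
  by_cases hI : I.IsPrime
  · obtain ⟨N, a, ha, hN⟩ := φ.exists_stable_of_prime he hR I
    obtain ⟨N', hN'⟩ := ih _ (hlt ha)
    refine ⟨max N N', fun n hn K _ _ _ _ hK => ?_⟩
    by_cases haK : algebraMap A K a = 0
    · exact hN' n (le_of_max_le_right hn) K (hker hK haK)
    · have h1 := hN K hK haK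
      have h2 := le_of_max_le_left hn
      rw [(φ.fiberMap K).iter_eq_of_eq_succ h1 h2,
        (φ.fiberMap K).iter_eq_of_eq_succ h1 (h2.trans n.le_succ)]
  -- If `ab ∈ I` with `a, b ∉ I`, a field-valued point killing `I` kills `a` or `b`, hence lies in
  -- one of two smaller closed sets.
  · rw [Ideal.isPrime_iff] at hI
    push Not at hI
    obtain ⟨a, b, hab, ha, hb⟩ := hI htop
    obtain ⟨N, hN⟩ := ih _ (hlt ha)
    obtain ⟨N', hN'⟩ := ih _ (hlt hb)
    refine ⟨max N N', fun n hn K _ _ _ _ hK => ?_⟩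
    rcases mul_eq_zero.1 ((map_mul (algebraMap A K) a b).symm.trans (hK _ hab)) with h1 | h1
    · exact hN n (le_of_max_le_left hn) K (hker hK h1)
    · exact hN' n (le_of_max_le_right hn) K (hker hK h1)

end Uniform

end

end RelFPure

namespace RelFPure

noncomputable section

/-! ## Compatibility with localization -/

section LocalizationAbsolute

variable {p e : ℕ} [Fact p.Prime] {S S' M M' : Type u} [CommRing S] [CommRing S'] [Algebra S S']
  [AddCommGroup M] [Module S M] [AddCommGroup M'] [Module S' M']

/-- The ideals `ψ^n(M)` are compatible with localization. -/
theorem CartierMap.iter_eq_map (ψ : CartierMap p e S M) (ψ' : CartierMap p e S' M') (g : S)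
    [IsLocalization.Away g S'] (Λ : M →+ M')
    (hΛ : ∀ (s : S) (m : M), Λ (s • m) = algebraMap S S' s • Λ m)
    (hsurj : ∀ m' : M', ∃ (k : ℕ) (m : M), algebraMap S S' (g ^ k) • m' = Λ m)
    (hψ : ∀ m, ψ'.toFun (Λ m) = algebraMap S S' (ψ.toFun m)) (n : ℕ) :
    ψ'.iter n = (ψ.iter n).map (algebraMap S S') := by
  induction n with
  | zero => rw [iter_zero, iter_zero, Ideal.map_top]
  | succ n ih =>
    rw [iter_succ, iter_succ]
    apply le_antisymm
    · refine CartierMap.mapIdeal_le fun a' ha' m' => ?_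
      rw [ih, IsLocalization.mem_map_algebraMap_iff (.powers g)] at ha'
      obtain ⟨⟨⟨a, ha⟩, ⟨_, i, rfl⟩⟩, hai⟩ := ha'
      obtain ⟨j, m, hm⟩ := hsurj m'
      dsimp only at hai
      obtain ⟨q, hq⟩ := Nat.exists_eq_succ_of_ne_zero
        (pow_ne_zero e (Fact.out : p.Prime).ne_zero : p ^ e ≠ 0)
      -- Only `p^e`-th powers can be pulled out of `ψ'`, so the denominator is overcleared: one
      -- factor `g^(i+j)` clears `a'` and `m'`, and the remaining `q = p^e - 1` factors are left on
      -- `m`.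
      have h1 : (algebraMap S S' (g ^ (i + j))) ^ p ^ e • a' • m' =
          Λ (a • ((g ^ (i + j)) ^ q) • m) := by
        rw [hΛ, hΛ, ← hm, ← hai, hq, pow_succ]
        simp only [smul_smul, ← map_pow, ← map_mul]
        congr 1
        simp only [map_mul, map_pow]
        ring
      have h2 := congrArg ψ'.toFun h1
      rw [ψ'.map_pow_smul, hψ] at h2
      have hu : IsUnit (algebraMap S S' (g ^ (i + j))) :=
        IsLocalization.map_units S' (⟨_, i + j, rfl⟩ : Submonoid.powers g)
      rw [← Ideal.unit_mul_mem_iff_mem _ hu, h2]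
      exact Ideal.mem_map_of_mem _ (ψ.apply_smul_mem_mapIdeal ha _)
    · rw [Ideal.map_le_iff_le_comap]
      refine CartierMap.mapIdeal_le fun a ha m => ?_
      rw [Ideal.mem_comap, ← hψ, hΛ, ih]
      exact ψ'.apply_smul_mem_mapIdeal (Ideal.mem_map_of_mem _ ha) _

end LocalizationAbsolute

section LocalizationRelative

variable {A A' R R' K : Type u} [CommRing A] [CommRing A'] [CommRing R] [CommRing R'] [CommRing K]
  [Algebra A R] [Algebra A' R'] [Algebra A A'] [Algebra R R'] [Algebra A K] [Algebra A' K]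
  [IsScalarTower A A' K]

/-- The map `R ⊗_A K → R' ⊗_{A'} K` induced by compatible maps `A → A'` and `R → R'`. -/
def fiberRestrict (K : Type u) [CommRing K] [Algebra A K] [Algebra A' K] [IsScalarTower A A' K]
    (hc : (algebraMap R R').comp (algebraMap A R) = (algebraMap A' R').comp (algebraMap A A')) :
    R ⊗[A] K →+* R' ⊗[A'] K :=
  Algebra.TensorProduct.mapRingHom (algebraMap A A') (algebraMap R R') (RingHom.id K) hc
    (by rw [RingHom.id_comp]; exact IsScalarTower.algebraMap_eq A A' K)

variable (hc : (algebraMap R R').comp (algebraMap A R) = (algebraMap A' R').comp (algebraMap A A'))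

theorem fiberRestrict_tmul (r : R) (k : K) :
    fiberRestrict K hc (r ⊗ₜ k) = algebraMap R R' r ⊗ₜ k := by
  simp [fiberRestrict]

/-- If `A → A'` is an epimorphism and `R → R'` is the localization away from `g`, then
`R ⊗_A K → R' ⊗_{A'} K` is the localization away from `g ⊗ 1`. -/
theorem isLocalization_fiberRestrict (g : R) [IsLocalization.Away g R']
    (hepi : ∀ (T : Type u) [CommRing T] (f₁ f₂ : A' →+* T),
      f₁.comp (algebraMap A A') = f₂.comp (algebraMap A A') → f₁ = f₂) :
    @IsLocalization.Away (R ⊗[A] K) _ (g ⊗ₜ 1) (R' ⊗[A'] K) _ (fiberRestrict K hc).toAlgebra := by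
  let _ : Algebra (R ⊗[A] K) (R' ⊗[A'] K) := (fiberRestrict K hc).toAlgebra
  have hpow (k : ℕ) : (g ⊗ₜ[A] (1 : K)) ^ k = (g ^ k) ⊗ₜ 1 := by
    rw [Algebra.TensorProduct.tmul_pow, one_pow]
  have hu : IsUnit (algebraMap R R' g) := IsLocalization.Away.algebraMap_isUnit g
  let T := Localization.Away (g ⊗ₜ[A] (1 : K))
  let t : R ⊗[A] K →+* T := algebraMap _ _
  have htg : IsUnit (t (g ⊗ₜ 1)) := IsLocalization.Away.algebraMap_isUnit _
  let f₁ : R' →+* T := IsLocalization.Away.lift (S := R') g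
    (g := t.comp Algebra.TensorProduct.includeLeftRingHom) htg
  have hf₁ (r : R) : f₁ (algebraMap R R' r) = t (r ⊗ₜ 1) := IsLocalization.Away.lift_eq g htg r
  let f₂ : K →+* T := t.comp (Algebra.TensorProduct.includeRight : K →ₐ[A] R ⊗[A] K).toRingHom
  -- The two structures of `A'`-algebra on `T` agree on `A`, hence agree because `A → A'` is an
  -- epimorphism.
  have hA' : f₁.comp (algebraMap A' R') = f₂.comp (algebraMap A' K) := by
    refine hepi T _ _ (RingHom.ext fun a => ?_)
    have h1 : algebraMap A' R' (algebraMap A A' a) = algebraMap R R' (algebraMap A R a) :=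
      congr($hc a).symm
    simp only [RingHom.comp_apply, h1, hf₁, ← IsScalarTower.algebraMap_apply]
    exact congrArg t (Algebra.TensorProduct.tmul_one_eq_one_tmul a)
  let _ : Algebra A' T := (f₁.comp (algebraMap A' R')).toAlgebra
  let F : R' ⊗[A'] K →ₐ[A'] T := Algebra.TensorProduct.lift
    { f₁ with commutes' := fun _ => rfl }
    { f₂ with commutes' := fun a => congr($hA' a).symm } fun _ _ => .all _ _
  have hF (x : R ⊗[A] K) : F (fiberRestrict K hc x) = t x := by
    induction x using TensorProduct.induction_on with
    | zero => simp
    | add x y hx hy => simp only [map_add, hx, hy]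
    | tmul r k =>
      rw [fiberRestrict_tmul]
      change f₁ (algebraMap R R' r) * t (1 ⊗ₜ k) = _
      rw [hf₁, ← map_mul]
      simp
  refine ⟨?_, ?_, ?_⟩
  · rintro ⟨_, k, rfl⟩
    change IsUnit (fiberRestrict K hc ((g ⊗ₜ 1) ^ k))
    rw [map_pow, fiberRestrict_tmul]
    exact (hu.map (Algebra.TensorProduct.includeLeftRingHom : R' →+* R' ⊗[A'] K)).pow k
  · intro z
    suffices h1 : ∃ (k : ℕ) (x : R ⊗[A] K), z * fiberRestrict K hc ((g ⊗ₜ 1) ^ k) =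
        fiberRestrict K hc x by
      obtain ⟨k, x, hx⟩ := h1
      exact ⟨⟨x, _, k, rfl⟩, hx⟩
    induction z using TensorProduct.induction_on with
    | zero => exact ⟨0, 0, by simp⟩
    | add z w hz hw =>
      obtain ⟨i, x, hx⟩ := hz
      obtain ⟨j, y, hy⟩ := hw
      refine ⟨i + j, (g ⊗ₜ 1) ^ j * x + (g ⊗ₜ 1) ^ i * y, ?_⟩
      rw [map_add, map_mul, map_mul, ← hx, ← hy, pow_add, map_mul]
      ring
    | tmul r k =>
      obtain ⟨n, s, hs⟩ := IsLocalization.Away.surj g r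
      refine ⟨n, s ⊗ₜ k, ?_⟩
      rw [hpow, fiberRestrict_tmul, fiberRestrict_tmul, ← hs, map_pow,
        Algebra.TensorProduct.tmul_mul_tmul, mul_one]
  · intro x y hxy
    have h1 : t x = t y := by rw [← hF, ← hF]; exact congrArg F hxy
    exact IsLocalization.exists_of_eq (M := Submonoid.powers (g ⊗ₜ[A] (1 : K))) h1

theorem exists_pow_mul_mem_of_map_le (g : R) [IsLocalization.Away g R']
    (hepi : ∀ (T : Type u) [CommRing T] (f₁ f₂ : A' →+* T),
      f₁.comp (algebraMap A A') = f₂.comp (algebraMap A A') → f₁ = f₂) (I J : Ideal (R ⊗[A] K))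
    (hIJ : I.map (fiberRestrict K hc) ≤ J.map (fiberRestrict K hc)) {x : R ⊗[A] K} (hx : x ∈ I) :
    ∃ k : ℕ, ((g ^ k) ⊗ₜ 1) * x ∈ J := by
  let _ : Algebra (R ⊗[A] K) (R' ⊗[A'] K) := (fiberRestrict K hc).toAlgebra
  have := isLocalization_fiberRestrict (K := K) hc g hepi
  obtain ⟨_, ⟨k, rfl⟩, hk⟩ := (IsLocalization.algebraMap_mem_map_algebraMap_iff
    (.powers (g ⊗ₜ[A] (1 : K))) (R' ⊗[A'] K) J x).1 (hIJ (Ideal.mem_map_of_mem _ hx))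
  refine ⟨k, ?_⟩
  simpa [Algebra.TensorProduct.tmul_pow] using hk

variable {p : ℕ} [Fact p.Prime] {h : (p : A) = 0} {h' : (p : A') = 0} {e : ℕ}
  {L L' : Type u} [AddCommGroup L] [Module R L] [AddCommGroup L'] [Module R' L']

/-- The map `R_{A^{1/p^m}} → R'_{A'^{1/p^m}}` induced by compatible maps `A → A'` and `R → R'`. -/
def rootRestrict (h : (p : A) = 0) (h' : (p : A') = 0) (m : ℕ)
    (hc : (algebraMap R R').comp (algebraMap A R) = (algebraMap A' R').comp (algebraMap A A')) :
    R ⊗[A] RootRing h m →+* R' ⊗[A'] RootRing h' m :=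
  Algebra.TensorProduct.mapRingHom (algebraMap A A') (algebraMap R R') (rootMap h h' m) hc
    (by ext a; simp [rootMap, algebraMap_root])

theorem rootRestrict_tmul (m : ℕ) (r : R) (a : RootRing h m) :
    rootRestrict h h' m hc (r ⊗ₜ a) = algebraMap R R' r ⊗ₜ rootMap h h' m a := by
  simp [rootRestrict]

theorem rootEval_rootRestrict (D : Type u) [CommRing D] [ExpChar D p] [PerfectRing D p]
    [Algebra A D] [Algebra A' D] [IsScalarTower A A' D] (m : ℕ) (x : R ⊗[A] RootRing h m) :
    rootEval D R' h' m (rootRestrict h h' m hc x) = fiberRestrict D hc (rootEval D R h m x) := by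
  induction x using TensorProduct.induction_on with
  | zero => simp
  | add x y hx hy => simp only [map_add, hx, hy]
  | tmul r a =>
    obtain ⟨a, rfl⟩ := (toRoot h m).surjective a
    rw [rootRestrict_tmul, rootEval_tmul, fiberRestrict_tmul, IsScalarTower.algebraMap_apply A A' D]
    rfl

/-- The map `(R ⊗_A K) ⊗_R L → (R' ⊗_{A'} K) ⊗_{R'} L'`. -/
def fiberModuleRestrict (K : Type u) [CommRing K] [Algebra A K] [Algebra A' K]
    [IsScalarTower A A' K]
    (hc : (algebraMap R R').comp (algebraMap A R) = (algebraMap A' R').comp (algebraMap A A'))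
    (l : L →+ L') (hl : ∀ (r : R) (x : L), l (r • x) = algebraMap R R' r • l x) :
    (R ⊗[A] K) ⊗[R] L →+ (R' ⊗[A'] K) ⊗[R'] L' :=
  TensorProduct.liftAddHom
    { toFun := fun s => (TensorProduct.mk R' (R' ⊗[A'] K) L'
        (fiberRestrict K hc s)).toAddMonoidHom.comp l
      map_zero' := by ext; simp
      map_add' := fun s t => by ext; simp }
    (fun r s x => by
      change fiberRestrict K hc (r • s) ⊗ₜ[R'] l x = fiberRestrict K hc s ⊗ₜ[R'] l (r • x)
      rw [hl, ← TensorProduct.smul_tmul, Algebra.smul_def, Algebra.smul_def, map_mul]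
      congr 2
      exact fiberRestrict_tmul hc r 1)

variable (l : L →+ L') (hl : ∀ (r : R) (x : L), l (r • x) = algebraMap R R' r • l x)

theorem fiberModuleRestrict_tmul (s : R ⊗[A] K) (x : L) :
    fiberModuleRestrict K hc l hl (s ⊗ₜ[R] x) = fiberRestrict K hc s ⊗ₜ[R'] l x := rfl

theorem fiberModuleRestrict_smul (s : R ⊗[A] K) (x : (R ⊗[A] K) ⊗[R] L) :
    fiberModuleRestrict K hc l hl (s • x) =
      fiberRestrict K hc s • fiberModuleRestrict K hc l hl x := by
  induction x using TensorProduct.induction_on with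
  | zero => simp
  | add x y hx hy => rw [smul_add, map_add, map_add, hx, hy, smul_add]
  | tmul t x => rw [TensorProduct.smul_tmul', fiberModuleRestrict_tmul, fiberModuleRestrict_tmul,
      TensorProduct.smul_tmul', smul_eq_mul, smul_eq_mul, map_mul]

theorem exists_pow_smul_eq_fiberModuleRestrict (g : R) [IsLocalization.Away g R']
    (hepi : ∀ (T : Type u) [CommRing T] (f₁ f₂ : A' →+* T),
      f₁.comp (algebraMap A A') = f₂.comp (algebraMap A A') → f₁ = f₂)
    (hsurj : ∀ x' : L', ∃ (k : ℕ) (x : L), algebraMap R R' (g ^ k) • x' = l x)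
    (z : (R' ⊗[A'] K) ⊗[R'] L') :
    ∃ (k : ℕ) (y : (R ⊗[A] K) ⊗[R] L),
      fiberRestrict K hc ((g ⊗ₜ 1) ^ k) • z = fiberModuleRestrict K hc l hl y := by
  induction z using TensorProduct.induction_on with
  | zero => exact ⟨0, 0, by simp⟩
  | add z w hz hw =>
    obtain ⟨i, x, hx⟩ := hz
    obtain ⟨j, y, hy⟩ := hw
    refine ⟨i + j, (g ⊗ₜ[A] (1 : K)) ^ j • x + (g ⊗ₜ[A] (1 : K)) ^ i • y, ?_⟩
    rw [map_add, fiberModuleRestrict_smul, fiberModuleRestrict_smul, ← hx, ← hy, smul_add,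
      smul_smul, smul_smul, ← map_mul, ← map_mul, ← pow_add, ← pow_add, add_comm j i]
  | tmul s x' =>
    let _ : Algebra (R ⊗[A] K) (R' ⊗[A'] K) := (fiberRestrict K hc).toAlgebra
    have := isLocalization_fiberRestrict (K := K) hc g hepi
    obtain ⟨i, t, ht⟩ := IsLocalization.Away.surj (g ⊗ₜ[A] (1 : K)) s
    obtain ⟨j, x, hx⟩ := hsurj x'
    refine ⟨i + j, t ⊗ₜ x, ?_⟩
    rw [fiberModuleRestrict_tmul, ← hx, ← TensorProduct.smul_tmul]
    have h1 : fiberRestrict K hc t = s * fiberRestrict K hc (g ⊗ₜ 1) ^ i := ht.symm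
    rw [h1, TensorProduct.smul_tmul']
    congr 1
    rw [smul_eq_mul, pow_add, map_mul, map_pow, map_pow, Algebra.smul_def, map_pow, map_pow]
    change _ = (algebraMap R R' g ⊗ₜ[A'] (1 : K)) ^ j * _
    rw [fiberRestrict_tmul]
    ring

end LocalizationRelative

section LocalizationFiber

variable {A A' R R' : Type u} [CommRing A] [CommRing A'] [CommRing R] [CommRing R']
  [Algebra A R] [Algebra A' R'] [Algebra A A'] [Algebra R R']
  {p : ℕ} [Fact p.Prime] {h : (p : A) = 0} {h' : (p : A') = 0} {e : ℕ}
  {L L' : Type u} [AddCommGroup L] [Module R L] [AddCommGroup L'] [Module R' L']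
  (hc : (algebraMap R R').comp (algebraMap A R) = (algebraMap A' R').comp (algebraMap A A'))
  (K : Type u) [Field K] [CharP K p] [PerfectField K]
  [Algebra A K] [Algebra A' K] [IsScalarTower A A' K]

theorem RelCartierMap.fiberMap_fiberModuleRestrict (φ : RelCartierMap h e R L)
    (φ' : RelCartierMap h' e R' L') (l : L →+ L')
    (hl : ∀ (r : R) (x : L), l (r • x) = algebraMap R R' r • l x)
    (hφ : ∀ x, φ'.toFun (l x) = rootRestrict h h' e hc (φ.toFun x)) (y : (R ⊗[A] K) ⊗[R] L) :
    (φ'.fiberMap K).toFun (fiberModuleRestrict K hc l hl y) =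
      fiberRestrict K hc ((φ.fiberMap K).toFun y) := by
  induction y using TensorProduct.induction_on with
  | zero => simp
  | add x y hx hy => simp only [map_add, hx, hy]
  | tmul s x =>
    induction s using TensorProduct.induction_on with
    | zero => simp
    | add s t hs ht => simp only [TensorProduct.add_tmul, map_add, hs, ht]
    | tmul r k =>
      rw [fiberModuleRestrict_tmul, fiberRestrict_tmul, φ'.fiberMap_tmul K, φ.fiberMap_tmul K, map_mul,
        ← rootEval_rootRestrict (h' := h'), ← hφ, hl, fiberRestrict_tmul, map_one]

theorem RelCartierMap.fiberMap_iter_eq_map (φ : RelCartierMap h e R L)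
    (φ' : RelCartierMap h' e R' L') (l : L →+ L')
    (hl : ∀ (r : R) (x : L), l (r • x) = algebraMap R R' r • l x)
    (hφ : ∀ x, φ'.toFun (l x) = rootRestrict h h' e hc (φ.toFun x))
    (g : R) [IsLocalization.Away g R']
    (hepi : ∀ (T : Type u) [CommRing T] (f₁ f₂ : A' →+* T),
      f₁.comp (algebraMap A A') = f₂.comp (algebraMap A A') → f₁ = f₂)
    (hsurj : ∀ x' : L', ∃ (k : ℕ) (x : L), algebraMap R R' (g ^ k) • x' = l x) (n : ℕ) :
    (φ'.fiberMap K).iter n = ((φ.fiberMap K).iter n).map (fiberRestrict K hc) := by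
  let _ : Algebra (R ⊗[A] K) (R' ⊗[A'] K) := (fiberRestrict K hc).toAlgebra
  have := isLocalization_fiberRestrict (K := K) hc g hepi
  exact CartierMap.iter_eq_map _ _ (g ⊗ₜ[A] (1 : K)) (fiberModuleRestrict K hc l hl)
    (fiberModuleRestrict_smul hc l hl) (exists_pow_smul_eq_fiberModuleRestrict hc l hl g hepi hsurj)
    (φ.fiberMap_fiberModuleRestrict hc K φ' l hl hφ) n

end LocalizationFiber

end

end RelFPure

namespace RelFPure

noncomputable section

/-! ## Sections of line bundles over affine open sets -/

section LineBundle

variable {X : Scheme.{u}} (L : X.Modules)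

/-- The restriction of sections of an `𝒪_X`-module. -/
def secRes {U W : X.Opens} (h : W ≤ U) : Γ(L, U) →+ Γ(L, W) := (L.presheaf.map (homOfLE h).op).hom

/-- The restriction of functions. -/
def funRes {U W : X.Opens} (h : W ≤ U) : Γ(X, U) →+* Γ(X, W) := (X.presheaf.map (homOfLE h).op).hom

theorem funRes_funRes {U W Z : X.Opens} (h : W ≤ U) (h' : Z ≤ W) (r : Γ(X, U)) :
    funRes h' (funRes h r) = funRes (h'.trans h) r :=
  congr($(X.presheaf.map_comp (homOfLE h).op (homOfLE h').op) r).symm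

theorem secRes_secRes {U W Z : X.Opens} (h : W ≤ U) (h' : Z ≤ W) (l : Γ(L, U)) :
    secRes L h' (secRes L h l) = secRes L (h'.trans h) l :=
  congr($(L.presheaf.map_comp (homOfLE h).op (homOfLE h').op) l).symm

theorem secRes_smul {U W : X.Opens} (h : W ≤ U) (r : Γ(X, U)) (l : Γ(L, U)) :
    secRes L h (r • l) = funRes h r • secRes L h l :=
  Scheme.Modules.map_smul L _ r l

theorem secRes_ext {ι : Type u} {U : X.Opens} (B : ι → X.Opens) (hB : ∀ i, B i ≤ U)
    (hU : U ≤ ⨆ i, B i) {l l' : Γ(L, U)} (h : ∀ i, secRes L (hB i) l = secRes L (hB i) l') :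
    l = l' :=
  TopCat.Sheaf.eq_of_locally_eq' (⟨L.presheaf, L.isSheaf⟩ : TopCat.Sheaf Ab X) B U
    (fun i => homOfLE (hB i)) hU l l' h

theorem exists_secRes_eq {ι : Type u} {U : X.Opens} (B : ι → X.Opens) (hB : ∀ i, B i ≤ U)
    (hU : U ≤ ⨆ i, B i) (l : ∀ i, Γ(L, B i))
    (h : ∀ i j, secRes L (inf_le_left : B i ⊓ B j ≤ B i) (l i) =
      secRes L (inf_le_right : B i ⊓ B j ≤ B j) (l j)) :
    ∃ l' : Γ(L, U), ∀ i, secRes L (hB i) l' = l i :=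
  (TopCat.Sheaf.existsUnique_gluing' (⟨L.presheaf, L.isSheaf⟩ : TopCat.Sheaf Ab X) B U
    (fun i => homOfLE (hB i)) hU l h).exists

/-- The section `l` generates `L` freely over `U`. -/
def IsFreeGenerator {U : X.Opens} (l : Γ(L, U)) : Prop :=
  ∀ (W : X.Opens) (h : W ≤ U), Function.Bijective fun r : Γ(X, W) => r • secRes L h l

variable {L}

/-- The generator is the image of `1` under a local trivialization; naturality and linearity
identify multiplication by its restrictions with the trivialization over each smaller open set. -/
theorem IsLineBundle.exists_isFreeGenerator (hL : IsLineBundle L) (x : X) :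
    ∃ U : X.Opens, x ∈ U ∧ ∃ l : Γ(L, U), IsFreeGenerator L l := by
  obtain ⟨U, hx, ⟨θ⟩⟩ := hL x
  let l : Γ(L.restrict U.ι, ⊤) := (Scheme.Modules.Hom.app θ.inv ⊤).hom (1 : Γ(U.toScheme, ⊤))
  refine ⟨U.ι ''ᵁ ⊤, by simpa using hx, l, fun W hW => ?_⟩
  obtain ⟨W, rfl⟩ : ∃ W' : U.toScheme.Opens, U.ι ''ᵁ W' = W :=
    ⟨U.ι ⁻¹ᵁ W, by rw [Scheme.Hom.image_preimage_eq_opensRange_inf]; simpa using hW⟩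
  have hθ : IsIso (Scheme.Modules.Hom.app θ.inv W) :=
    Scheme.Modules.Hom.isIso_iff_isIso_app.1 ⟨θ.hom, θ.inv_hom_id, θ.hom_inv_id⟩ W
  have h1 : Function.Bijective (Scheme.Modules.Hom.app θ.inv W).hom :=
    ConcreteCategory.bijective_of_isIso (Scheme.Modules.Hom.app θ.inv W)
  have h2 : Function.Bijective (U.ι.appIso W).hom :=
    ConcreteCategory.bijective_of_isIso (U.ι.appIso W).hom
  have h3 (r : Γ(X, U.ι ''ᵁ W)) : (Scheme.Modules.Hom.app θ.inv W).hom
      ((U.ι.appIso W).hom r : Γ(U.toScheme, W)) = r • secRes L hW l := by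
    have h4 := Scheme.Modules.Hom.app_smul θ.inv ((U.ι.appIso W).hom r : Γ(U.toScheme, W))
      (1 : Γ(U.toScheme, W))
    have h5 := congr($(θ.inv.mapPresheaf.naturality (homOfLE (le_top : W ≤ ⊤)).op)
      (1 : Γ(U.toScheme, ⊤)))
    have h6 : (Scheme.Modules.Hom.app θ.inv W).hom (1 : Γ(U.toScheme, W)) = secRes L hW l := by
      refine Eq.trans ?_ h5
      exact congrArg (Scheme.Modules.Hom.app θ.inv W).hom
        (map_one (U.toScheme.presheaf.map (homOfLE (le_top : W ≤ ⊤)).op).hom).symm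
    have h7 : (U.ι.appIso W).inv ((U.ι.appIso W).hom r) = r :=
      congr($((U.ι.appIso W).hom_inv_id) r)
    rw [h6] at h4
    refine Eq.trans ?_ (h4.trans (congrArg (· • secRes L hW l) h7))
    exact congrArg (Scheme.Modules.Hom.app θ.inv W).hom (mul_one ((U.ι.appIso W).hom r : Γ(U.toScheme, W))).symm
  exact (funext h3) ▸ h1.comp h2

theorem IsFreeGenerator.exists_pow_smul_eq_zero {U : X.Opens} {l : Γ(L, U)}
    (hl : IsFreeGenerator L l) {B W : X.Opens} (hB : IsAffineOpen B) (hBU : B ≤ U) (g : Γ(X, B))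
    (hW : W = X.basicOpen g) (hWB : W ≤ B) (m : Γ(L, B)) (hm : secRes L hWB m = 0) :
    ∃ k : ℕ, g ^ k • m = 0 := by
  obtain ⟨r, rfl⟩ := (hl B hBU).2 m
  let _ : Algebra Γ(X, B) Γ(X, W) := (X.presheaf.map (homOfLE hWB).op).hom.toAlgebra
  have := hB.isLocalization_of_eq_basicOpen g (homOfLE hWB) hW
  dsimp only at hm ⊢
  rw [secRes_smul, secRes_secRes] at hm
  have h1 : funRes hWB r = 0 := (hl W (hWB.trans hBU)).1 (by simpa using hm)
  obtain ⟨⟨_, k, rfl⟩, hk⟩ := IsLocalization.exists_of_eq (M := Submonoid.powers g) (S := Γ(X, W))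
    (x := r) (y := 0) (h1.trans (map_zero _).symm)
  refine ⟨k, ?_⟩
  rw [smul_smul]
  dsimp only at hk
  rw [hk, mul_zero, zero_smul]

theorem IsFreeGenerator.exists_secRes_eq_pow_smul {U : X.Opens} {l : Γ(L, U)}
    (hl : IsFreeGenerator L l) {B W : X.Opens} (hB : IsAffineOpen B) (hBU : B ≤ U) (g : Γ(X, B))
    (hW : W = X.basicOpen g) (hWB : W ≤ B) (m : Γ(L, W)) :
    ∃ (k : ℕ) (m' : Γ(L, B)), secRes L hWB m' = funRes hWB (g ^ k) • m := by
  obtain ⟨r, rfl⟩ := (hl W (hWB.trans hBU)).2 m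
  let _ : Algebra Γ(X, B) Γ(X, W) := (X.presheaf.map (homOfLE hWB).op).hom.toAlgebra
  have := hB.isLocalization_of_eq_basicOpen g (homOfLE hWB) hW
  obtain ⟨k, s, hs⟩ := IsLocalization.Away.surj g r
  refine ⟨k, s • secRes L hBU l, ?_⟩
  have h1 : funRes hWB s = r * funRes hWB g ^ k := hs.symm
  rw [secRes_smul, secRes_secRes, h1, smul_smul, map_pow, mul_comm]

/-- Sections of a line bundle over a basic open subset of an affine open set `U` extend to `U`
after multiplication with a power of the function defining the subset. -/
theorem IsLineBundle.exists_secRes_eq_pow_smul (hL : IsLineBundle L) {U W : X.Opens}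
    (hU : IsAffineOpen U) (g : Γ(X, U)) (hW : W = X.basicOpen g) (hWU : W ≤ U) (m : Γ(L, W)) :
    ∃ (k : ℕ) (m' : Γ(L, U)), secRes L hWU m' = funRes hWU (g ^ k) • m := by
  -- These functions define basic opens on which `L` is free, where extension is a statement about
  -- localizations of rings. Finitely many of them cover `U`, so exponents can be made uniform.
  let s : Set Γ(X, U) := {a | ∃ (Z : X.Opens) (l : Γ(L, Z)),
    IsFreeGenerator L l ∧ X.basicOpen a ≤ Z}
  have hs : Ideal.span s = ⊤ := by
    rw [← hU.self_le_iSup_basicOpen_iff]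
    intro x hx
    obtain ⟨Z, hxZ, l, hl⟩ := hL.exists_isFreeGenerator x
    obtain ⟨a, haZ, hxa⟩ := hU.exists_basicOpen_le (⟨x, hxZ⟩ : Z) hx
    exact Opens.mem_iSup.2 ⟨⟨a, Z, l, hl, haZ⟩, hxa⟩
  obtain ⟨t, hts, ht⟩ := (Ideal.span_eq_top_iff_finite s).1 hs
  rw [← hU.self_le_iSup_basicOpen_iff] at ht
  let B (i : t) : X.Opens := X.basicOpen i.1
  have hB (i : t) : B i ≤ U := X.basicOpen_le _
  have hBaff (i : t) : IsAffineOpen (B i) := hU.basicOpen _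
  have hBaff' (i j : t) : IsAffineOpen (B i ⊓ B j) := by
    rw [← X.basicOpen_mul]
    exact hU.basicOpen _
  have hres {Z : X.Opens} (hZ : Z ≤ U) : Z ⊓ W = X.basicOpen (funRes hZ g) := by
    rw [hW]
    exact (X.basicOpen_res g _).symm
  choose Z l hl hZ using fun i : t => hts i.2
  choose k m' hm' using fun i : t => (hl i).exists_secRes_eq_pow_smul (hBaff i) (hZ i)
    (funRes (hB i) g) (hres (hB i)) inf_le_left (secRes L inf_le_right m)
  let k₀ := Finset.univ.sup k
  obtain ⟨n, hn⟩ : ∃ n : ∀ i, Γ(L, B i), ∀ i, secRes L (inf_le_left : B i ⊓ W ≤ B i) (n i) =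
      funRes ((inf_le_left : B i ⊓ W ≤ B i).trans (hB i)) (g ^ k₀) •
        secRes L (inf_le_right : B i ⊓ W ≤ W) m := by
    refine ⟨fun i => funRes (hB i) (g ^ (k₀ - k i)) • m' i, fun i => ?_⟩
    rw [secRes_smul, hm', smul_smul, ← map_pow, funRes_funRes, funRes_funRes, ← map_mul, ← pow_add,
      Nat.sub_add_cancel (Finset.le_sup (Finset.mem_univ i))]
  -- The local extensions agree over `W`, so on overlaps their difference is killed by a power of
  -- `g`; a further common power makes them glue.
  have h1 (i j : t) : ∃ c : ℕ, funRes ((inf_le_left : B i ⊓ B j ≤ B i).trans (hB i)) g ^ c •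
      (secRes L (inf_le_left : B i ⊓ B j ≤ B i) (n i) -
        secRes L (inf_le_right : B i ⊓ B j ≤ B j) (n j)) = 0 := by
    refine (hl i).exists_pow_smul_eq_zero (hBaff' i j) (inf_le_left.trans (hZ i)) _
      (hres (inf_le_left.trans (hB i))) inf_le_left _ ?_
    have h2 := congrArg (secRes L (inf_le_inf_right W inf_le_left : B i ⊓ B j ⊓ W ≤ B i ⊓ W)) (hn i)
    have h3 := congrArg (secRes L (inf_le_inf_right W inf_le_right : B i ⊓ B j ⊓ W ≤ B j ⊓ W)) (hn j)
    simp only [secRes_smul, secRes_secRes, funRes_funRes] at h2 h3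
    rw [map_sub, secRes_secRes, secRes_secRes, h2, h3, sub_self]
  choose c hc using h1
  let c₀ := Finset.univ.sup fun q : t × t => c q.1 q.2
  obtain ⟨m₀, hm₀⟩ := exists_secRes_eq L B hB ht (fun i => funRes (hB i) (g ^ c₀) • n i)
    (fun i j => by
      rw [← sub_eq_zero, secRes_smul, secRes_smul, funRes_funRes, funRes_funRes, ← smul_sub]
      have h2 : c₀ = (c₀ - c i j) + c i j :=
        (Nat.sub_add_cancel (Finset.le_sup (f := fun q : t × t => c q.1 q.2)
          (Finset.mem_univ (i, j)))).symm
      rw [h2, pow_add, map_mul, mul_smul, map_pow _ g (c i j), hc, smul_zero])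
  refine ⟨c₀ + k₀, m₀, ?_⟩
  refine secRes_ext L (fun i : t => B i ⊓ W) (fun i => inf_le_right) ?_ fun i => ?_
  · rw [← iSup_inf_eq]
    exact le_inf (hWU.trans ht) le_rfl
  · have h2 := congrArg (secRes L (inf_le_left : B i ⊓ W ≤ B i)) (hm₀ i)
    rw [secRes_smul, hn, secRes_secRes, funRes_funRes, smul_smul, ← map_mul, ← pow_add] at h2
    rw [secRes_secRes, h2, secRes_smul, funRes_funRes]

end LineBundle

end

end RelFPure

namespace RelFPure

noncomputable section

/-! ## Restriction to smaller charts -/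

section Charts

variable {X V : Scheme.{u}} {f : X ⟶ V}

namespace Chart

variable (c d : Chart f)

/-- The restriction `𝒪_V(W) → 𝒪_V(W')`. -/
abbrev restrictBase (hW : d.W ≤ c.W) : Algebra c.A d.A := RingHom.toAlgebra (funRes hW)

/-- The restriction `𝒪_X(U) → 𝒪_X(U')`. -/
abbrev restrictSource (hU : d.U ≤ c.U) : Algebra c.R d.R := RingHom.toAlgebra (funRes hU)

theorem restrict_comp (hU : d.U ≤ c.U) (hW : d.W ≤ c.W) :
    letI := c.restrictBase d hW
    letI := c.restrictSource d hU
    (algebraMap c.R d.R).comp (algebraMap c.A c.R) =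
      (algebraMap d.A d.R).comp (algebraMap c.A d.A) := by
  refine RingHom.ext fun a => ?_
  have h1 := f.appLE_map c.le (homOfLE hU).op
  have h2 := f.map_appLE d.le (homOfLE hW).op
  exact congr($(h1.trans h2.symm) a)

variable {p : ℕ} [Fact p.Prime] (hV : (p : Γ(V, ⊤)) = 0) (e : ℕ)

theorem twistOpen_mono (hU : d.U ≤ c.U) (hW : d.W ≤ c.W) : d.twistOpen hV e ≤ c.twistOpen hV e :=
  inf_le_inf (fun _ hx => hU hx) (fun _ hx => hW hx)

theorem twistEquiv_rootRestrict (hU : d.U ≤ c.U) (hW : d.W ≤ c.W)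
    (y : c.R ⊗[c.A] RootRing (c.natCast_A hV) e) :
    letI := c.restrictBase d hW
    letI := c.restrictSource d hU
    d.twistEquiv hV e (rootRestrict (c.natCast_A hV) (d.natCast_A hV) e
      (c.restrict_comp d hU hW) y) =
    funRes (c.twistOpen_mono d hV e hU hW) (c.twistEquiv hV e y) := by
  let _ := c.restrictBase d hW
  let _ := c.restrictSource d hU
  induction y using TensorProduct.induction_on with
  | zero => simp
  | add x y hx hy => simp only [map_add, hx, hy]
  | tmul r a =>
    have h1 : (r ⊗ₜ[c.A] a) = (r ⊗ₜ 1) * (1 ⊗ₜ a) := by simp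
    rw [h1, map_mul, map_mul, map_mul, map_mul, twistEquiv_left, twistEquiv_right,
      rootRestrict_tmul, rootRestrict_tmul, map_one, map_one, twistEquiv_left, twistEquiv_right]
    congr 1
    · have h2 := (pullback.fst f (absFrobenius hV e)).appLE_map
        (inf_le_left : c.twistOpen hV e ≤ _) (homOfLE (c.twistOpen_mono d hV e hU hW)).op
      have h3 := (pullback.fst f (absFrobenius hV e)).map_appLE
        (inf_le_left : d.twistOpen hV e ≤ _) (homOfLE hU).op
      exact congr($(h3.trans h2.symm) r)
    · have h2 := (pullback.snd f (absFrobenius hV e)).appLE_map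
        (inf_le_right : c.twistOpen hV e ≤ _) (homOfLE (c.twistOpen_mono d hV e hU hW)).op
      have h3 := (pullback.snd f (absFrobenius hV e)).map_appLE
        (inf_le_right : d.twistOpen hV e ≤ _) (homOfLE hW).op
      exact congr($(h3.trans h2.symm) a)

/-- This is naturality of the sheaf map `φ` under restriction, read through the ring isomorphisms
`twistEquiv`. -/
theorem localMap_secRes {L : X.Modules} (φ : RelMap f hV e L) (hU : d.U ≤ c.U) (hW : d.W ≤ c.W)
    (x : c.Sec L) :
    letI := c.restrictBase d hW
    letI := c.restrictSource d hU
    (d.localMap hV e φ).toFun (secRes L hU x) =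
      rootRestrict (c.natCast_A hV) (d.natCast_A hV) e (c.restrict_comp d hU hW)
        ((c.localMap hV e φ).toFun x) := by
  let _ := c.restrictBase d hW
  let _ := c.restrictSource d hU
  apply (d.twistEquiv hV e).injective
  rw [twistEquiv_rootRestrict]
  have h1 (c : Chart f) (x : c.Sec L) : c.twistEquiv hV e ((c.localMap hV e φ).toFun x) =
      (Scheme.Modules.Hom.app φ (c.twistOpen hV e)).hom
        (secRes L (c.preimage_twistOpen_le hV e) x) :=
    (c.twistEquiv hV e).apply_symm_apply _
  refine (h1 d (secRes L hU x)).trans (Eq.trans ?_ (congrArg (funRes _) (h1 c x)).symm)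
  have h2 := congr($((Scheme.Modules.Hom.mapPresheaf φ).naturality
    (homOfLE (c.twistOpen_mono d hV e hU hW)).op)
    (secRes L (c.preimage_twistOpen_le hV e) x))
  refine Eq.trans (congrArg _ ?_) h2
  exact (secRes_secRes L _ _ x).trans (secRes_secRes L _ _ x).symm

theorem isScalarTower_point {K : Type u} [Field K] (s : Spec (.of K) ⟶ V) (hW : d.W ≤ c.W)
    (hc : ⊤ ≤ s ⁻¹ᵁ c.W) (hd : ⊤ ≤ s ⁻¹ᵁ d.W) :
    letI := c.restrictBase d hW
    letI := c.pointAlgebra s hc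
    letI := d.pointAlgebra s hd
    IsScalarTower c.A d.A K := by
  let _ := c.restrictBase d hW
  let _ := c.pointAlgebra s hc
  let _ := d.pointAlgebra s hd
  refine IsScalarTower.of_algebraMap_eq fun a => ?_
  have h1 := s.map_appLE hd (homOfLE hW).op
  exact congr((Scheme.ΓSpecIso (.of K)).hom ($h1 a)).symm

theorem restrictBase_hom_ext (hW : d.W ≤ c.W) (a : c.A)
    (ha : d.W = V.basicOpen (U := c.W) a)
    (T : Type u) [CommRing T] (f₁ f₂ : d.A →+* T)
    (h : f₁.comp (funRes hW) = f₂.comp (funRes hW)) : f₁ = f₂ := by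
  let _ : Algebra c.A d.A := c.restrictBase d hW
  have : IsLocalization.Away a d.A :=
    c.affine_W.isLocalization_of_eq_basicOpen a (homOfLE hW) ha
  exact IsLocalization.ringHom_ext (Submonoid.powers a) h

theorem le_preimage_basicOpen {K : Type u} [Field K] {s : Spec (.of K) ⟶ V} (hs : ⊤ ≤ s ⁻¹ᵁ c.W) (a : c.A)
    (ha : letI := c.pointAlgebra s hs; algebraMap c.A K a ≠ 0) :
    ⊤ ≤ s ⁻¹ᵁ V.basicOpen (U := c.W) a := by
  have h1 : IsUnit (s.appLE c.W ⊤ hs a) :=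
    (isUnit_map_iff (Scheme.ΓSpecIso (.of K)).commRingCatIsoToRingEquiv _).1 (IsUnit.mk0 _ ha)
  have h2 := (Scheme.basicOpen_appLE s _ _ hs a).symm.trans (Scheme.basicOpen_of_isUnit _ h1)
  exact inf_eq_left.1 h2

variable {L : X.Modules} (φ : RelMap f hV e L) {K : Type u} [Field K] [CharP K p] [PerfectField K]
  (s : Spec (.of K) ⟶ V)

/-- The images of the `n`-th and the `(n+1)`-st iterate agree on the fiber over `s`. -/
def StableAt (hs : ⊤ ≤ s ⁻¹ᵁ c.W) (n : ℕ) : Prop :=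
  letI := c.pointAlgebra s hs
  ((c.localMap hV e φ).fiberMap K).iter n ≤ ((c.localMap hV e φ).fiberMap K).iter (n + 1)

theorem fiberMap_iter_eq_map (hL : IsLineBundle L) (hU : d.U ≤ c.U) (hW : d.W ≤ c.W) (g : c.R)
    (hg : d.U = X.basicOpen (U := c.U) g) (a : c.A) (ha : d.W = V.basicOpen (U := c.W) a)
    (hc : ⊤ ≤ s ⁻¹ᵁ c.W) (hd : ⊤ ≤ s ⁻¹ᵁ d.W) (n : ℕ) :
    letI := c.restrictBase d hW
    letI := c.restrictSource d hU
    letI := c.pointAlgebra s hc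
    letI := d.pointAlgebra s hd
    haveI := c.isScalarTower_point d s hW hc hd
    ((d.localMap hV e φ).fiberMap K).iter n =
      (((c.localMap hV e φ).fiberMap K).iter n).map
        (fiberRestrict K (c.restrict_comp d hU hW)) := by
  let _ := c.restrictBase d hW
  let _ := c.restrictSource d hU
  let _ := c.pointAlgebra s hc
  let _ := d.pointAlgebra s hd
  have := c.isScalarTower_point d s hW hc hd
  have : IsLocalization.Away g d.R := c.affine_U.isLocalization_of_eq_basicOpen g (homOfLE hU) hg
  refine RelCartierMap.fiberMap_iter_eq_map (c.restrict_comp d hU hW) K (c.localMap hV e φ)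
    (d.localMap hV e φ) (secRes L hU) (secRes_smul L hU) (c.localMap_secRes d hV e φ hU hW) g
    (fun T _ => c.restrictBase_hom_ext d hW a ha T) (fun x => ?_) n
  obtain ⟨k, m, hm⟩ := hL.exists_secRes_eq_pow_smul c.affine_U g hg hU x
  exact ⟨k, m, hm.symm⟩

variable {hV e φ s c d}

theorem StableAt.restrict (hL : IsLineBundle L) (hU : d.U ≤ c.U) (hW : d.W ≤ c.W) (g : c.R)
    (hg : d.U = X.basicOpen (U := c.U) g) (a : c.A) (ha : d.W = V.basicOpen (U := c.W) a)
    {hc : ⊤ ≤ s ⁻¹ᵁ c.W} (hd : ⊤ ≤ s ⁻¹ᵁ d.W) {n : ℕ} (h : c.StableAt hV e φ s hc n) :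
    d.StableAt hV e φ s hd n := by
  rw [StableAt, c.fiberMap_iter_eq_map d hV e φ s hL hU hW g hg a ha hc hd,
    c.fiberMap_iter_eq_map d hV e φ s hL hU hW g hg a ha hc hd]
  exact Ideal.map_mono h

/-- Stability on the smaller chart is an inclusion of localized ideals, so each element satisfies it
up to a power of `g`. -/
theorem StableAt.exists_pow_mul_mem (hL : IsLineBundle L) (hU : d.U ≤ c.U) (hW : d.W ≤ c.W)
    (g : c.R) (hg : d.U = X.basicOpen (U := c.U) g) (a : c.A)
    (ha : d.W = V.basicOpen (U := c.W) a) (hc : ⊤ ≤ s ⁻¹ᵁ c.W) {hd : ⊤ ≤ s ⁻¹ᵁ d.W} {n : ℕ}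
    (h : d.StableAt hV e φ s hd n) :
    letI := c.pointAlgebra s hc
    ∀ x ∈ ((c.localMap hV e φ).fiberMap K).iter n, ∃ k : ℕ,
      ((g ^ k) ⊗ₜ 1) * x ∈ ((c.localMap hV e φ).fiberMap K).iter (n + 1) := by
  let _ := c.restrictBase d hW
  let _ := c.restrictSource d hU
  let _ := c.pointAlgebra s hc
  let _ := d.pointAlgebra s hd
  have := c.isScalarTower_point d s hW hc hd
  have : IsLocalization.Away g d.R := c.affine_U.isLocalization_of_eq_basicOpen g (homOfLE hU) hg
  intro x hx
  refine exists_pow_mul_mem_of_map_le (c.restrict_comp d hU hW) g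
    (fun T _ => c.restrictBase_hom_ext d hW a ha T) _ _ ?_ hx
  rw [StableAt, c.fiberMap_iter_eq_map d hV e φ s hL hU hW g hg a ha hc hd,
    c.fiberMap_iter_eq_map d hV e φ s hL hU hW g hg a ha hc hd] at h
  exact h

/-- Stability on a fiber can be checked on an open cover by charts. -/
theorem stableAt_of_cover (hL : IsLineBundle L) (c : Chart f) (hs : ⊤ ≤ s ⁻¹ᵁ c.W) (n : ℕ)
    (h : ∀ x ∈ c.U, ∃ c' : Chart f, x ∈ c'.U ∧ ∀ hs' : ⊤ ≤ s ⁻¹ᵁ c'.W, c'.StableAt hV e φ s hs' n) :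
    c.StableAt hV e φ s hs n := by
  let _ := c.pointAlgebra s hs
  intro y hy
  let I := ((c.localMap hV e φ).fiberMap K).iter (n + 1)
  -- The multipliers of `y` into the target are taken in `R`, not in `R ⊗ K`, so that `1 ∈ J` can be
  -- checked at the points of `U`.
  let J : Ideal c.R := (I.colon {y}).comap
    (Algebra.TensorProduct.includeLeftRingHom : c.R →+* c.R ⊗[c.A] K)
  have hJ (t : c.R) : t ∈ J ↔ (t ⊗ₜ 1) * y ∈ I := Submodule.mem_colon_singleton
  suffices hJtop : J = ⊤ by
    have := (hJ 1).1 (hJtop ▸ trivial)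
    rwa [← Algebra.TensorProduct.one_def, one_mul] at this
  rw [← Ideal.span_eq J]
  refine c.affine_U.self_le_iSup_basicOpen_iff.1 fun x hx => ?_
  suffices key : ∃ t ∈ J, x ∈ X.basicOpen (U := c.U) t by
    obtain ⟨t, ht, hxt⟩ := key
    exact Opens.mem_iSup.2 ⟨⟨t, ht⟩, hxt⟩
  have hzero (a : c.A) (ha : algebraMap c.A K a = 0) :
      algebraMap c.A c.R a ⊗ₜ[c.A] (1 : K) = 0 := by
    rw [Algebra.TensorProduct.tmul_one_eq_one_tmul, ha, TensorProduct.tmul_zero]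
  obtain ⟨c', hx', hc'⟩ := h x hx
  obtain ⟨a, b, hab, hxa⟩ := exists_basicOpen_le_affine_inter c.affine_W c'.affine_W (f x)
    ⟨c.le hx, c'.le hx'⟩
  obtain ⟨g, g', hgg, hxg⟩ := exists_basicOpen_le_affine_inter c.affine_U c'.affine_U x ⟨hx, hx'⟩
  have hxa' : x ∈ X.basicOpen (f.appLE c.W c.U c.le a) := by
    rw [Scheme.basicOpen_appLE]
    exact ⟨hx, hxa⟩
  -- If `a` vanishes at `s`, its pullback is zero on the fiber and lies in `J` trivially. Otherwise
  -- `s` factors through the basic open set of `a`, hence through the base of `c'`.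
  by_cases ha : algebraMap c.A K a = 0
  · have h0 := hzero a ha
    exact ⟨algebraMap c.A c.R a, (hJ _).2 ((congrArg (· * y) h0).trans (zero_mul y) ▸ zero_mem I),
      hxa'⟩
  have hsa := le_preimage_basicOpen c hs a ha
  -- Multiplying by the pullback of `a` forces the basic open set to lie over that of `a`; the
  -- resulting chart is basic in both `c` and `c'`, on source and base.
  let G : Γ(X, c.U) := g * f.appLE c.W c.U c.le a
  let G' : Γ(X, c'.U) := g' * f.appLE c'.W c'.U c'.le b
  have hG : X.basicOpen G = X.basicOpen g ⊓ f ⁻¹ᵁ V.basicOpen a := by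
    rw [Scheme.basicOpen_mul, Scheme.basicOpen_appLE, ← inf_assoc,
      inf_eq_left.2 (X.basicOpen_le g)]
  have hG' : X.basicOpen G' = X.basicOpen g' ⊓ f ⁻¹ᵁ V.basicOpen b := by
    rw [Scheme.basicOpen_mul, Scheme.basicOpen_appLE, ← inf_assoc,
      inf_eq_left.2 (X.basicOpen_le g')]
  have hGG : X.basicOpen G = X.basicOpen G' := by rw [hG, hG', hgg, hab]
  let d : Chart f :=
    { U := X.basicOpen G
      W := V.basicOpen a
      affine_U := c.affine_U.basicOpen _
      affine_W := c.affine_W.basicOpen _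
      le := hG.trans_le inf_le_right }
  have hs' : ⊤ ≤ s ⁻¹ᵁ c'.W := hsa.trans fun z hz => (V.basicOpen_le b) (hab ▸ hz)
  have hd : d.StableAt hV e φ s hsa n := (hc' hs').restrict hL (hGG.trans_le (X.basicOpen_le _))
    (hab.trans_le (V.basicOpen_le _)) G' hGG b hab hsa
  obtain ⟨k, hk⟩ := hd.exists_pow_mul_mem hL (X.basicOpen_le _) (V.basicOpen_le _) G rfl a rfl hs y
    hy
  -- A positive exponent is needed for `G` and its power to have the same basic open set.
  refine ⟨G ^ (k + 1), J.pow_mem_of_pow_mem ((hJ _).2 hk) k.le_succ, ?_⟩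
  have h1 : x ∈ X.basicOpen G := hG ▸ ⟨hxg, hxa⟩
  rwa [← Scheme.basicOpen_pow _ G (n := k + 1) k.succ_pos] at h1

end Chart

end Charts

end

end RelFPure

namespace RelFPure

/-! ### From charts to a bound valid on all of `X` -/

section Main

variable {p : ℕ} [Fact p.Prime] {X V : Scheme.{u}} (f : X ⟶ V)

theorem exists_chart (x : X) : ∃ c : Chart f, x ∈ c.U := by
  obtain ⟨W, hW, hxW, -⟩ := V.isBasis_affineOpens.exists_subset_of_mem_open
    (Set.mem_univ (f x)) isOpen_univ
  obtain ⟨U, hU, hxU, hUW⟩ := X.isBasis_affineOpens.exists_subset_of_mem_open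
    (show x ∈ (f ⁻¹ᵁ ⟨W, V.isBasis_affineOpens.isOpen hW⟩ : X.Opens) from hxW)
    (f ⁻¹ᵁ ⟨W, V.isBasis_affineOpens.isOpen hW⟩ : X.Opens).isOpen
  obtain ⟨U, hU', rfl⟩ := hU
  obtain ⟨W, hW', rfl⟩ := hW
  exact ⟨⟨U, W, hU', hW', hUW⟩, hxU⟩

variable {f}

theorem Chart.exists_forall_stableAt [IsLocallyNoetherian V] [LocallyOfFiniteType f]
    (hV : (p : Γ(V, ⊤)) = 0) {e : ℕ} (he : 0 < e) {L : X.Modules} (φ : RelMap f hV e L)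
    (c : Chart f) :
    ∃ N, ∀ n, N ≤ n → ∀ (K : Type u) [Field K] [CharP K p] [PerfectField K]
      (s : Spec (.of K) ⟶ V) (hs : ⊤ ≤ s ⁻¹ᵁ c.W), c.StableAt hV e φ s hs n := by
  have : IsNoetherianRing c.A := IsLocallyNoetherian.component_noetherian ⟨c.W, c.affine_W⟩
  have : Algebra.FiniteType c.A c.R := f.finiteType_appLE c.affine_W c.affine_U c.le
  obtain ⟨N, hN⟩ := (c.localMap hV e φ).exists_forall_iter_le_succ he (c.natCast_R hV)
  exact ⟨N, fun n hn K _ _ _ s hs => @hN n hn K _ _ _ (c.pointAlgebra s hs)⟩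

/-- Compactness of `X` leaves finitely many bounds, whose supremum is `N`. An arbitrary chart then
needs no bound of its own, since stability on its fibers is tested on the finite cover. -/
theorem exists_forall_chart_stableAt [AlgebraicGeometry.IsNoetherian V] [LocallyOfFiniteType f]
    [QuasiCompact f] (hV : (p : Γ(V, ⊤)) = 0) {e : ℕ} (he : 0 < e) {L : X.Modules}
    (hL : IsLineBundle L) (φ : RelMap f hV e L) :
    ∃ N, ∀ n, N ≤ n → ∀ (K : Type u) [Field K] [CharP K p] [PerfectField K]
      (s : Spec (.of K) ⟶ V) (c : Chart f) (hs : ⊤ ≤ s ⁻¹ᵁ c.W), c.StableAt hV e φ s hs n := by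
  have : CompactSpace X := QuasiCompact.compactSpace_of_compactSpace f
  choose c hc using exists_chart f
  obtain ⟨t, ht⟩ := isCompact_univ.elim_nhds_subcover (fun x => ((c x).U : Set X))
    fun x _ => (c x).U.isOpen.mem_nhds (hc x)
  choose N hN using fun x => (c x).exists_forall_stableAt hV he φ
  refine ⟨t.sup N, fun n hn K _ _ _ s d hs => d.stableAt_of_cover hL hs n fun x _ => ?_⟩
  obtain ⟨y, hy, hxy⟩ := Set.mem_iUnion₂.1 (ht.2 (Set.mem_univ x))
  exact ⟨c y, hxy, fun hs' => hN y n ((Finset.le_sup hy).trans hn) K s hs'⟩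

end Main

end RelFPure

theorem mainTheorem1 {p : ℕ} [Fact p.Prime] {X V : Scheme.{u}} (f : X ⟶ V)
    [AlgebraicGeometry.IsNoetherian V] [IsIntegral V] (hV : (p : Γ(V, ⊤)) = 0)
    [LocallyOfFiniteType f] [QuasiCompact f] [IsSeparated f] [Flat f] [GeometricallyReduced f]
    (e : ℕ) (he : 0 < e) (L : X.Modules) (hL : RelFPure.IsLineBundle L) (φ : RelFPure.RelMap f hV e L) :
    (∃ N : ℕ, ∀ n : ℕ, N ≤ n →
      ∀ (K : Type u) [Field K] [CharP K p] [PerfectField K] (s : Spec (.of K) ⟶ V)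
        (c : RelFPure.Chart f) (hs : ⊤ ≤ s ⁻¹ᵁ c.W),
        letI := c.pointAlgebra s hs
        (c.localMap hV e φ).sigmaOnFiber K (c.natCast_R hV) n = (c.localMap hV e φ).fiberSigma K) ∧
    (∀ (n : ℕ) (T : Scheme.{u}) (g : T ⟶ V) (c : RelFPure.Chart f) (O : T.Opens), IsAffineOpen O →
        ∀ hO : O ≤ g ⁻¹ᵁ c.W,
        letI := c.baseAlgebra g O hO
        (c.localMap hV e φ).sigmaExtended (c.natCast_R hV)
            (RelFPure.natCast_section (RelFPure.natCast_source g hV) O) n =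
          (c.localMap hV e φ).sigmaBaseChange (RelFPure.natCast_section (RelFPure.natCast_source g hV) O) n) := by
  refine ⟨?_, fun n T g c O _ hO => ?_⟩
  · obtain ⟨N, hN⟩ := RelFPure.exists_forall_chart_stableAt hV he hL φ
    refine ⟨N, fun n hn K _ _ _ s c hs => ?_⟩
    let _ := c.pointAlgebra s hs
    rw [RelFPure.RelCartierMap.sigmaOnFiber_eq_iter]
    -- Stability at the single index `N` makes the chain constant from there on, so its intersection
    -- is the `n`-th term.
    exact (RelFPure.CartierMap.sigma_eq_iter _ _ (hN N le_rfl K s c hs) hn).symm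
  · let _ := c.baseAlgebra g O hO
    exact RelFPure.RelCartierMap.sigmaExtended_eq _ _ _ n
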